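/- For each prime $p$ the following statements are equivalent. (1) There exists an infinite finitely presented residually finite $p$-group (that is, an infinite finitely presented group which is residually finite and in which the order of every element is a power of $p$). (2) There exists a finitely generated $p$-conjugacy separable subgroup $G \leqslant H \times H$, where $H$ is the free group of rank $2$, such that $G$ is not virtually a direct product of two free groups; that is, no subgroup of finite index in $G$ is isomorphic to a direct product of two free groups (where one or both of the free factors may be trivial). (3) There exist free groups $F_1$, $F_2$ and a finitely generated $p$-conjugacy separable full subdirect product $G \leqslant F_1 \times F_2$ such that $|(F_1 \times F_2) : G| = \infty$. Here a group $G$ is called $p$-conjugacy separable if for any two non-conjugate elements $x, y \in G$ there are a finite $p$-group $M$ and a homomorphism $\varphi : G \to M$ such that $\varphi(x)$ and $\varphi(y)$ are not conjugate in $M$. A subgroup $G \leqslant F_1 \times F_2$ is a full subdirect product of $F_1$ and $F_2$ if $G$ projects onto both $F_1$ and $F_2$, and both $G \cap (F_1 \times \{1\})$ and $G \cap (\{1\} \times F_2)$ are non-trivial. -/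

import Mathlib

universe u

/-- A group `G` is `p`-conjugacy separable if any two non-conjugate elements of `G` have
non-conjugate images under some homomorphism from `G` to a finite `p`-group. (Every finite group is
isomorphic to one whose underlying type lives in `Type`, so no finite `p`-group is missed.) -/
def IsPConjugacySeparable (p : ℕ) (G : Type u) [Group G] : Prop :=
  ∀ x y : G, ¬ IsConj x y →
    ∃ (M : Type) (_ : Group M), Finite M ∧ IsPGroup p M ∧
      ∃ φ : G →* M, ¬ IsConj (φ x) (φ y)

/-- A subgroup `G` of `F₁ × F₂` is a subdirect product if both coordinate projections map it onto
the respective factor. -/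
def IsSubdirectProduct {F₁ F₂ : Type u} [Group F₁] [Group F₂] (G : Subgroup (F₁ × F₂)) : Prop :=
  G.map (MonoidHom.fst F₁ F₂) = ⊤ ∧ G.map (MonoidHom.snd F₁ F₂) = ⊤

/-- A full subdirect product of `F₁` and `F₂`: a subdirect product that intersects both
`F₁ × {1}` and `{1} × F₂` non-trivially. -/
def IsFullSubdirectProduct {F₁ F₂ : Type u} [Group F₁] [Group F₂]
    (G : Subgroup (F₁ × F₂)) : Prop :=
  IsSubdirectProduct G ∧
    G ⊓ Subgroup.prod (⊤ : Subgroup F₁) (⊥ : Subgroup F₂) ≠ ⊥ ∧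
    G ⊓ Subgroup.prod (⊥ : Subgroup F₁) (⊤ : Subgroup F₂) ≠ ⊥

/-- `G` is isomorphic to a direct product of two free groups. The ranks are arbitrary, and one or
both of the free groups may be trivial. -/
def IsDirectProductOfTwoFreeGroups (G : Type u) [Group G] : Prop :=
  ∃ A B : Type u, Nonempty (G ≃* FreeGroup A × FreeGroup B)

/-- `G` is virtually a direct product of two free groups: some subgroup of finite index is
isomorphic to such a product. -/
def IsVirtuallyDirectProductOfTwoFreeGroups (G : Type u) [Group G] : Prop :=
  ∃ K : Subgroup G, K.FiniteIndex ∧ IsDirectProductOfTwoFreeGroups K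

/-! The bridge between groups `P` and subgroups `G` of `F₁ × F₂` is the fibre product. A subdirect
product `G` has normal kernels `N₁ = G ∩ F₁` and `N₂ = G ∩ F₂`, of infinite index when `G` has
infinite index; conversely a presentation `ψ : F → P` has a fibre square, both of whose kernels are
`ker ψ`.

(1 → 3) The fibre square is generated by the diagonal and the relators. If `(x, y)` and `(axa⁻¹,
byb⁻¹)` lie in it, the possible conjugators are the pairs in `aC(x) × bC(y)` with equal images in
`P`. For nontrivial `x`, `y` the centralizers are cyclic, so their images in the torsion group `P`
are finite, and non-conjugacy amounts to finitely many inequalities in `P`. A finite `p`-quotient of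
`P` detects these, and `IsFreeGroup.exists_isPOpen_centralizer` transfers them to a finite
`p`-quotient of the fibre square. That lemma rests on `p`-conjugacy separability of free groups,
`FreeGroup.isPConjugacySeparable`: conjugacy in a mod `p` Fox extension forces some vertex of the
path of `x` to be carried to a vertex of the path of `y`, leaving finitely many candidate
conjugators.

(3 → 1) Take `P = F₁/N₁`. Finite presentability comes from the normal generators of the kernel of `G
→ F₂`. The other two properties are read off from test pairs `(x, y)` and `(gxg⁻¹, y)`, where `x`
and `y` generate their own centralizers. Such elements exist in every coset of an infinite-index
nontrivial normal subgroup, by `FreeGroup.exists_mem_forall_pow_ne`.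

(2 ↔ 3) Finitely generated free groups embed in the free group of rank two, and any `G` is subdirect
in the product of its projections. If `G` is full of infinite index, commutation in free groups
forces a decomposition of a finite-index subgroup into two free factors to be the given one
(`IsFreeGroup.fst_mem_of_mulEquiv_prod`), so `N₁` would have finite index. If `G` is not full, it is
free; if it has finite index, it contains `N₁ × N₂` with finite index. -/

open scoped Pointwise

/-! ### Kernels of maps to finite `p`-groups. -/

/-- `K` is a normal subgroup of finite index whose quotient is a `p`-group. -/
structure IsPOpen (p : ℕ) {G : Type*} [Group G] (K : Subgroup G) : Prop where
  normal : K.Normal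
  finiteIndex : K.FiniteIndex
  exists_pow_mem : ∀ g : G, ∃ k : ℕ, g ^ p ^ k ∈ K

namespace IsPOpen

variable {p : ℕ} {G H : Type*} [Group G] [Group H]

theorem top : IsPOpen p (⊤ : Subgroup G) := ⟨inferInstance, inferInstance, fun _ => ⟨0, trivial⟩⟩

theorem pow_mem_of_le {K : Subgroup G} {g : G} {k l : ℕ} (h : g ^ p ^ k ∈ K) (hkl : k ≤ l) :
    g ^ p ^ l ∈ K := by
  obtain ⟨m, rfl⟩ := Nat.exists_eq_add_of_le hkl
  rw [pow_add, pow_mul]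
  exact K.pow_mem h _

theorem inf {K L : Subgroup G} (hK : IsPOpen p K) (hL : IsPOpen p L) : IsPOpen p (K ⊓ L) := by
  have := hK.normal
  have := hL.normal
  have := hK.finiteIndex
  have := hL.finiteIndex
  refine ⟨inferInstance, inferInstance, fun g => ?_⟩
  obtain ⟨k, hk⟩ := hK.exists_pow_mem g
  obtain ⟨l, hl⟩ := hL.exists_pow_mem g
  exact ⟨max k l, pow_mem_of_le hk (le_max_left _ _), pow_mem_of_le hl (le_max_right _ _)⟩

/-- Finitely many conditions, each met by all small enough subgroups, can be met at once. -/
theorem exists_forall_finset {ι : Type*} (s : Finset ι) (P : ι → Subgroup G → Prop)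
    (hmono : ∀ i K L, K ≤ L → P i L → P i K) (h : ∀ i ∈ s, ∃ K, IsPOpen p K ∧ P i K) :
    ∃ K, IsPOpen p K ∧ ∀ i ∈ s, P i K := by
  classical
  induction s using Finset.induction_on with
  | empty => exact ⟨⊤, top, by simp⟩
  | insert a s _ ih =>
    obtain ⟨K, hK, hKs⟩ := ih fun i hi => h i (Finset.mem_insert_of_mem hi)
    obtain ⟨L, hL, hLa⟩ := h a (Finset.mem_insert_self _ _)
    refine ⟨K ⊓ L, hK.inf hL, fun i hi => ?_⟩
    rcases Finset.mem_insert.1 hi with rfl | hi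
    · exact hmono _ _ _ inf_le_right hLa
    · exact hmono _ _ _ inf_le_left (hKs i hi)

theorem comap {K : Subgroup H} (hK : IsPOpen p K) (f : G →* H) : IsPOpen p (K.comap f) := by
  have := hK.normal
  have := hK.finiteIndex
  have hker : ((QuotientGroup.mk' K).comp f).ker = K.comap f := by
    rw [← MonoidHom.comap_ker, QuotientGroup.ker_mk']
  exact ⟨inferInstance, hker ▸ Subgroup.finiteIndex_ker _,
    fun g => by simpa using hK.exists_pow_mem (f g)⟩

theorem ker [Finite H] (hH : IsPGroup p H) (f : G →* H) : IsPOpen p f.ker :=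
  ⟨inferInstance, Subgroup.finiteIndex_ker f, fun g => by
    obtain ⟨k, hk⟩ := hH (f g)
    exact ⟨k, by simpa [MonoidHom.mem_ker] using hk⟩⟩

theorem isPGroup_quotient {K : Subgroup G} (hK : IsPOpen p K) [K.Normal] : IsPGroup p (G ⧸ K) := by
  intro g
  obtain ⟨g, rfl⟩ := QuotientGroup.mk_surjective g
  obtain ⟨k, hk⟩ := hK.exists_pow_mem g
  exact ⟨k, by rwa [← QuotientGroup.mk_pow, QuotientGroup.eq_one_iff]⟩

theorem exists_uniform_pow_mem {K : Subgroup G} (hK : IsPOpen p K) :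
    ∃ k : ℕ, ∀ g : G, g ^ p ^ k ∈ K := by
  have := hK.normal
  have := hK.finiteIndex
  obtain ⟨k, hk⟩ := isPGroup_iff_exists_pow_pow_eq_one.1 hK.isPGroup_quotient
  refine ⟨k, fun g => ?_⟩
  have := hk (g : G ⧸ K)
  rwa [← QuotientGroup.mk_pow, QuotientGroup.eq_one_iff] at this

end IsPOpen

/-- Only the kernel of the separating homomorphism matters, and kernels, unlike homomorphisms, can
be intersected and pulled back. `Shrink` moves the finite quotient into `Type`. -/
theorem isPConjugacySeparable_iff_exists_isPOpen {p : ℕ} {G : Type*} [Group G] :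
    IsPConjugacySeparable p G ↔ ∀ x y : G, ¬ IsConj x y →
      ∃ K : Subgroup G, IsPOpen p K ∧ ∀ g, g * x * g⁻¹ * y⁻¹ ∉ K := by
  constructor
  · intro h x y hxy
    obtain ⟨M, _, _, hM, φ, hφ⟩ := h x y hxy
    refine ⟨φ.ker, IsPOpen.ker hM φ, fun g hg => hφ (isConj_iff.2 ⟨φ g, ?_⟩)⟩
    rw [MonoidHom.mem_ker, map_mul, map_inv, mul_inv_eq_one] at hg
    simpa using hg
  · intro h x y hxy
    obtain ⟨K, hK, hg⟩ := h x y hxy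
    have := hK.normal
    have := hK.finiteIndex
    let e : Shrink.{0} (G ⧸ K) ≃* G ⧸ K := Shrink.mulEquiv
    refine ⟨Shrink.{0} (G ⧸ K), inferInstance, Finite.of_equiv _ e.symm.toEquiv,
      hK.isPGroup_quotient.of_equiv e.symm, e.symm.toMonoidHom.comp (QuotientGroup.mk' K), ?_⟩
    intro hc
    obtain ⟨c, hc⟩ := isConj_iff.1 hc
    obtain ⟨g, hgc⟩ := QuotientGroup.mk_surjective (e c)
    have h2 := congrArg e hc
    simp only [MonoidHom.comp_apply, MulEquiv.coe_toMonoidHom, map_mul, map_inv,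
      MulEquiv.apply_symm_apply, ← hgc] at h2
    refine hg g ((QuotientGroup.eq_one_iff _).1 ?_)
    rw [QuotientGroup.mk_mul, QuotientGroup.mk_inv, mul_inv_eq_one]
    exact h2

theorem IsPConjugacySeparable.of_mulEquiv {p : ℕ} {G H : Type*} [Group G] [Group H] (e : G ≃* H)
    (h : IsPConjugacySeparable p G) : IsPConjugacySeparable p H := by
  intro x y hxy
  obtain ⟨M, i1, i2, hM, φ, hφ⟩ := h (e.symm x) (e.symm y) fun hc => hxy (by
    simpa using MonoidHom.map_isConj e.toMonoidHom hc)
  exact ⟨M, i1, i2, hM, φ.comp e.symm.toMonoidHom, hφ⟩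

/-- A nontrivial finite `p`-group maps onto the cyclic group of order `p`. -/
theorem IsPGroup.exists_surjective_zmod {p : ℕ} [hp : Fact p.Prime] {J : Type*} [Group J] [Finite J]
    [Nontrivial J] (hJ : IsPGroup p J) :
    ∃ ψ : J →* Multiplicative (ZMod p), Function.Surjective ψ := by
  obtain ⟨n, hn, hc⟩ := hJ.nontrivial_iff_card.1 inferInstance
  obtain ⟨m, rfl⟩ : ∃ m, n = m + 1 := ⟨n - 1, by omega⟩
  obtain ⟨H, hH⟩ := Sylow.exists_subgroup_card_pow_prime p
    (show p ^ m ∣ Nat.card J from hc ▸ pow_dvd_pow _ (by omega))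
  have hidx : H.index = p := by
    have := H.card_mul_index
    rw [hH, hc, pow_succ] at this
    exact Nat.eq_of_mul_eq_mul_left (pow_pos hp.out.pos _) this
  have : H.Normal := Subgroup.normal_of_index_eq_minFac_card (by
    rw [hidx, hc, Nat.pow_minFac (by omega), hp.out.minFac_eq])
  have hcard : Nat.card (J ⧸ H) = Nat.card (Multiplicative (ZMod p)) := by
    rw [← Subgroup.index_eq_card, hidx]
    simp
  have hcp : Nat.card (J ⧸ H) = p := by rw [← Subgroup.index_eq_card, hidx]
  let e : J ⧸ H ≃* Multiplicative (ZMod p) := mulEquivOfPrimeCardEq hcp (hcard ▸ hcp)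
  exact ⟨e.toMonoidHom.comp (QuotientGroup.mk' H),
    e.surjective.comp (QuotientGroup.mk'_surjective H)⟩

/-! ### The mod `p` Fox extension of a quotient of a free group. -/

/-- The semidirect product `(ℤ/p)[X × Q] ⋊ Q`: for a quotient `Q` of the free group on `X`, the
first component collects mod `p` chains of the Cayley graph of `Q`. -/
@[ext]
structure CayleyChainExtension (X Q : Type*) (p : ℕ) where
  chain : X × Q →₀ ZMod p
  base : Q

namespace CayleyChainExtension

variable {X Q Q' : Type*} {p : ℕ}

theorem finite [Finite X] [Finite Q] [NeZero p] : Finite (CayleyChainExtension X Q p) :=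
  Finite.of_injective (fun a => ((a.chain : X × Q → ZMod p), a.base)) fun a b h => by
    ext1
    · exact DFunLike.coe_injective (Prod.ext_iff.1 h).1
    · exact (Prod.ext_iff.1 h).2

variable [Group Q] [Group Q']

/-- The translation action of `Q` on chains. -/
noncomputable def shift (q : Q) : (X × Q →₀ ZMod p) →+ (X × Q →₀ ZMod p) :=
  Finsupp.mapDomain.addMonoidHom fun e => (e.1, q * e.2)

theorem shift_single (q : Q) (x : X) (g : Q) (c : ZMod p) :
    shift q (Finsupp.single (x, g) c) = Finsupp.single (x, q * g) c :=
  Finsupp.mapDomain_single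

theorem shift_one (c : X × Q →₀ ZMod p) : shift 1 c = c := by
  simp only [shift, one_mul]
  exact Finsupp.mapDomain_id

theorem shift_mul (q r : Q) (c : X × Q →₀ ZMod p) : shift (q * r) c = shift q (shift r c) := by
  simp only [shift, Finsupp.mapDomain.addMonoidHom_apply, ← Finsupp.mapDomain_comp]
  congr 1
  ext e <;> simp [mul_assoc]

theorem shift_apply (q : Q) (c : X × Q →₀ ZMod p) (x : X) (g : Q) :
    shift q c (x, g) = c (x, q⁻¹ * g) := by
  have hinj : Function.Injective fun e : X × Q => (e.1, q * e.2) := by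
    rintro ⟨a, b⟩ ⟨a', b'⟩ h
    simpa using h
  have := Finsupp.mapDomain_apply hinj c (x, q⁻¹ * g)
  simpa [shift] using this

noncomputable instance : Mul (CayleyChainExtension X Q p) :=
  ⟨fun a b => ⟨a.chain + shift a.base b.chain, a.base * b.base⟩⟩

noncomputable instance : One (CayleyChainExtension X Q p) := ⟨⟨0, 1⟩⟩

noncomputable instance : Inv (CayleyChainExtension X Q p) :=
  ⟨fun a => ⟨-shift a.base⁻¹ a.chain, a.base⁻¹⟩⟩

@[simp] theorem mul_chain (a b : CayleyChainExtension X Q p) :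
    (a * b).chain = a.chain + shift a.base b.chain := rfl
@[simp] theorem mul_base (a b : CayleyChainExtension X Q p) :
    (a * b).base = a.base * b.base := rfl
@[simp] theorem one_chain : (1 : CayleyChainExtension X Q p).chain = 0 := rfl
@[simp] theorem one_base : (1 : CayleyChainExtension X Q p).base = 1 := rfl
@[simp] theorem inv_chain (a : CayleyChainExtension X Q p) :
    a⁻¹.chain = -shift a.base⁻¹ a.chain := rfl
@[simp] theorem inv_base (a : CayleyChainExtension X Q p) : a⁻¹.base = a.base⁻¹ := rfl

noncomputable instance : Group (CayleyChainExtension X Q p) :=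
  Group.ofLeftAxioms
    (fun a b c => by ext1 <;> simp [shift_mul, add_assoc, mul_assoc])
    (fun a => by ext1 <;> simp [shift_one])
    (fun a => by ext1 <;> simp)

/-- The projection onto the quotient `Q`. -/
noncomputable def baseHom : CayleyChainExtension X Q p →* Q where
  toFun := base
  map_one' := rfl
  map_mul' _ _ := rfl

@[simp] theorem pow_base (a : CayleyChainExtension X Q p) (n : ℕ) : (a ^ n).base = a.base ^ n :=
  map_pow baseHom a n

theorem chain_pow_of_base_eq_one (a : CayleyChainExtension X Q p) (h : a.base = 1) (n : ℕ) :
    (a ^ n).chain = n • a.chain := by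
  induction n with
  | zero => simp
  | succ n ih => rw [pow_succ', mul_chain, ih, h, shift_one, succ_nsmul']

/-- The chains form an abelian normal subgroup, so conjugation on them depends on the base alone. -/
theorem conj_chain_of_base_eq_one (c a : CayleyChainExtension X Q p) (h : a.base = 1) :
    (c * a * c⁻¹).chain = shift c.base a.chain := by
  simp [h, ← shift_mul, shift_one]

theorem isPGroup (hQ : IsPGroup p Q) : IsPGroup p (CayleyChainExtension X Q p) := by
  intro a
  obtain ⟨k, hk⟩ := hQ a.base
  -- The power `p ^ k` kills the base; one more factor `p` kills the remaining chain.
  refine ⟨k + 1, ?_⟩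
  rw [pow_succ, pow_mul]
  have hb : (a ^ p ^ k).base = 1 := by simpa using hk
  ext1
  · rw [chain_pow_of_base_eq_one _ hb]
    ext e
    simp
  · simp [hk]

/-- The Fox homomorphism: a word is sent to the chain of the path it labels in the Cayley graph. -/
noncomputable def fox (p : ℕ) (π : FreeGroup X →* Q) : FreeGroup X →* CayleyChainExtension X Q p :=
  FreeGroup.lift fun x => ⟨Finsupp.single (x, 1) 1, π (FreeGroup.of x)⟩

@[simp] theorem fox_of (π : FreeGroup X →* Q) (x : X) :
    fox p π (FreeGroup.of x) = ⟨Finsupp.single (x, 1) 1, π (FreeGroup.of x)⟩ := by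
  simp [fox]

@[simp] theorem fox_base (π : FreeGroup X →* Q) (w : FreeGroup X) : (fox p π w).base = π w := by
  have : baseHom.comp (fox p π) = π := by
    ext x
    simp [baseHom]
  exact DFunLike.congr_fun this w

/-- The homomorphism of extensions induced by a homomorphism of the quotients. -/
noncomputable def mapBase (f : Q →* Q') :
    CayleyChainExtension X Q p →* CayleyChainExtension X Q' p where
  toFun a := ⟨Finsupp.mapDomain (Prod.map id f) a.chain, f a.base⟩
  map_one' := by ext1 <;> simp
  map_mul' a b := by
    ext1
    · simp only [mul_chain, Finsupp.mapDomain_add, shift, Finsupp.mapDomain.addMonoidHom_apply,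
        ← Finsupp.mapDomain_comp]
      congr 2
      ext e <;> simp
    · simp

theorem fox_comp (π : FreeGroup X →* Q) (f : Q →* Q') (w : FreeGroup X) :
    (fox p (f.comp π) w).chain = Finsupp.mapDomain (Prod.map id f) (fox p π w).chain := by
  have : fox p (f.comp π) = (mapBase f).comp (fox p π) := by
    ext1 x
    simp [mapBase, Finsupp.mapDomain_single]
  rw [this]
  rfl

/-- Mod `p` homology classes of the cover are detected by chains: a loop that is nontrivial under
some homomorphism to `ℤ/p` has a nonzero chain. -/
theorem fox_chain_ne_zero (π : FreeGroup X →* Q) (hπ : Function.Surjective π)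
    (ψ : π.ker →* Multiplicative (ZMod p)) (w : π.ker) (hw : ψ w ≠ 1) :
    (fox p π (w : FreeGroup X)).chain ≠ 0 := by
  obtain ⟨s, hs⟩ := hπ.hasRightInverse
  have hmem (v : Q) (u : FreeGroup X) : s v * u * (s (v * π u))⁻¹ ∈ π.ker := by
    simp [MonoidHom.mem_ker, hs _]
  -- The path labelled `u` from the vertex `v` is closed up to a loop by the transversal `s`, and
  -- `ψ` is evaluated on that loop. This is a cocycle in `u`.
  let T (v : Q) (u : FreeGroup X) : ZMod p := (ψ ⟨_, hmem v u⟩).toAdd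
  have hTmul (v : Q) (u u' : FreeGroup X) : T v (u * u') = T v u + T (v * π u) u' := by
    simp only [T, ← toAdd_mul, ← map_mul]
    congr 2
    ext
    simp [mul_assoc]
  -- The linear functional on chains that agrees with `T v` on single edges; the cocycle rule then
  -- gives agreement on all paths, so `ψ` depends only on the chain.
  let Λ (v : Q) : (X × Q →₀ ZMod p) →+ ZMod p :=
    Finsupp.liftAddHom fun e => (AddMonoidHom.mulRight (T (v * e.2) (FreeGroup.of e.1)))
  have hΛsingle (v : Q) (x : X) (q : Q) (c : ZMod p) :
      Λ v (Finsupp.single (x, q) c) = c * T (v * q) (FreeGroup.of x) := by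
    simp [Λ]
  have hΛshift (v q : Q) (c : X × Q →₀ ZMod p) : Λ v (shift q c) = Λ (v * q) c := by
    suffices h : (Λ v).comp (shift q) = Λ (v * q) from DFunLike.congr_fun h c
    refine Finsupp.addHom_ext fun e c => ?_
    obtain ⟨x, r⟩ := e
    rw [AddMonoidHom.comp_apply, shift_single, hΛsingle, hΛsingle, mul_assoc]
  have key (u : FreeGroup X) : ∀ v, Λ v (fox p π u).chain = T v u := by
    have hone (v : Q) : T v 1 = 0 := by
      have := hTmul v 1 1
      simp only [mul_one, map_one] at this
      simpa using this
    induction u using FreeGroup.induction_on with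
    | C1 => intro v; simp [hone]
    | of x => intro v; rw [fox_of, hΛsingle]; simp
    | inv_of x ih =>
      intro v
      have h1 := hTmul v (FreeGroup.of x)⁻¹ (FreeGroup.of x)
      rw [inv_mul_cancel, hone] at h1
      rw [map_inv, inv_chain, map_neg, hΛshift, fox_base, ih, ← map_inv]
      exact neg_eq_of_add_eq_zero_left h1.symm
    | mul u u' ih ih' =>
      intro v
      rw [map_mul, mul_chain, map_add, hΛshift, ih, ih', fox_base, hTmul]
  intro h0
  have h1 := key w 1
  rw [h0, map_zero] at h1
  apply hw
  have hs1 : s 1 ∈ π.ker := by rw [MonoidHom.mem_ker, hs]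
  have h2 : (⟨_, hmem 1 w⟩ : π.ker) = ⟨s 1, hs1⟩ * w * (⟨s 1, hs1⟩)⁻¹ := by
    ext
    have : π w = 1 := w.2
    simp [this]
  have h3 : T 1 w = (ψ w).toAdd := by
    simp only [T]
    rw [h2]
    simp
  rw [h3] at h1
  exact h1.symm

end CayleyChainExtension

open CayleyChainExtension

/-! ### Residual `p`-finiteness and `p`-conjugacy separability of free groups. -/

/-- A nontrivial free group maps nontrivially to `ℤ/p`. -/
theorem IsFreeGroup.exists_hom_zmod_ne_one (p : ℕ) [Fact p.Prime] {R : Type*} [Group R]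
    [IsFreeGroup R] [Nontrivial R] :
    ∃ (ψ : R →* Multiplicative (ZMod p)) (w : R), ψ w ≠ 1 := by
  have e := IsFreeGroup.toFreeGroup R
  have hne : Nonempty (IsFreeGroup.Generators R) := by
    by_contra h
    rw [not_nonempty_iff] at h
    exact not_subsingleton R e.injective.subsingleton
  obtain ⟨a⟩ := hne
  refine ⟨(FreeGroup.lift fun _ => Multiplicative.ofAdd (1 : ZMod p)).comp e.toMonoidHom,
    e.symm (FreeGroup.of a), ?_⟩
  simp

namespace FreeGroup

variable {X : Type*} {p : ℕ}

theorem isPOpen_ker_fox [hp : Fact p.Prime] [Finite X] {K : Subgroup (FreeGroup X)}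
    (hK : IsPOpen p K) [K.Normal] : IsPOpen p (fox p (QuotientGroup.mk' K)).ker := by
  have := hK.finiteIndex
  have : Finite (CayleyChainExtension X (FreeGroup X ⧸ K) p) := CayleyChainExtension.finite
  exact IsPOpen.ker (CayleyChainExtension.isPGroup hK.isPGroup_quotient) _

theorem ker_fox_le (K : Subgroup (FreeGroup X)) [K.Normal] :
    (fox p (QuotientGroup.mk' K)).ker ≤ K := by
  intro w hw
  have := congrArg CayleyChainExtension.base (MonoidHom.mem_ker.1 hw)
  rw [fox_base] at this
  exact (QuotientGroup.eq_one_iff w).1 this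

theorem fox_mk'_chain_ne_zero (K : Subgroup (FreeGroup X)) [K.Normal]
    (ψ : K →* Multiplicative (ZMod p)) (w : K) (hw : ψ w ≠ 1) :
    (fox p (QuotientGroup.mk' K) (w : FreeGroup X)).chain ≠ 0 := by
  let e : (QuotientGroup.mk' K).ker ≃* K := MulEquiv.subgroupCongr (QuotientGroup.ker_mk' K)
  exact fox_chain_ne_zero (QuotientGroup.mk' K) (QuotientGroup.mk'_surjective K)
    (ψ.comp e.toMonoidHom) (e.symm w) (by simpa using hw)

/-- Free groups are residually `p`-finite. -/
theorem exists_isPOpen_notMem [hp : Fact p.Prime] [Finite X] {w : FreeGroup X} (hw : w ≠ 1) :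
    ∃ K, IsPOpen p K ∧ w ∉ K := by
  classical
  by_contra! hcon
  -- If the intersection `R` of all `p`-open subgroups is nontrivial, it is free, so some `u` in `R`
  -- has a nonzero chain over the quotient by `R`.
  let R : Subgroup (FreeGroup X) := sInf {K | IsPOpen p K}
  have hR {g} : g ∈ R ↔ ∀ K, IsPOpen p K → g ∈ K := Subgroup.mem_sInf
  have : R.Normal := ⟨fun n hn g => hR.2 fun K hK => hK.normal.conj_mem n (hR.1 hn K hK) g⟩
  have : Nontrivial R := ⟨⟨w, hR.2 hcon⟩, 1, fun h => hw (congrArg Subtype.val h)⟩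
  obtain ⟨ψ, u, hu⟩ := IsFreeGroup.exists_hom_zmod_ne_one p (R := R)
  have hc := fox_mk'_chain_ne_zero R ψ u hu
  set c := (fox p (QuotientGroup.mk' R) (u : FreeGroup X)).chain with hcdef
  -- A `p`-open `K` that separates these finitely many vertices keeps the chain of `u` nonzero,
  -- whereas `u` lies in the `p`-open kernel of the Fox map of `K`.
  let T := c.support.image Prod.snd
  obtain ⟨K, hK, hKT⟩ := IsPOpen.exists_forall_finset (p := p) (T ×ˢ T)
    (fun i K => i.1 ≠ i.2 → (Quotient.out i.1)⁻¹ * Quotient.out i.2 ∉ K)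
    (fun i K L hKL h hi hmem => h hi (hKL hmem)) (by
      rintro ⟨q, r⟩ -
      by_cases hqr : q = r
      · exact ⟨⊤, IsPOpen.top, fun h => (h hqr).elim⟩
      · have hnot : (Quotient.out q)⁻¹ * Quotient.out r ∉ R := by
          intro h
          apply hqr
          have := QuotientGroup.eq.2 h
          simpa using this
        rw [hR] at hnot
        push Not at hnot
        obtain ⟨K, hK, hKn⟩ := hnot
        exact ⟨K, hK, fun _ => hKn⟩)
  have := hK.normal
  have hRK : R ≤ K := fun g hg => hR.1 hg K hK
  let f : FreeGroup X ⧸ R →* FreeGroup X ⧸ K :=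
    QuotientGroup.map R K (MonoidHom.id _) (by simpa using hRK)
  have hf : f.comp (QuotientGroup.mk' R) = QuotientGroup.mk' K := rfl
  have hzero : (fox p (QuotientGroup.mk' K) (u : FreeGroup X)).chain = 0 := by
    have := hR.1 u.2 _ (isPOpen_ker_fox hK)
    rw [MonoidHom.mem_ker] at this
    rw [this, one_chain]
  rw [← hf, fox_comp, ← hcdef] at hzero
  have hinj : Set.InjOn (Prod.map id f) (c.support : Set (X × FreeGroup X ⧸ R)) := by
    rintro ⟨a, q⟩ hq ⟨b, r⟩ hr h
    have h1 : a = b := (Prod.ext_iff.1 h).1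
    have h2 : f q = f r := (Prod.ext_iff.1 h).2
    subst h1
    by_contra hne
    have hqr : q ≠ r := fun h => hne (by rw [h])
    refine hKT (q, r) (Finset.mem_product.2 ⟨Finset.mem_image_of_mem _ hq,
      Finset.mem_image_of_mem _ hr⟩) hqr ?_
    have h3 : f (Quotient.out q : FreeGroup X) = f (Quotient.out r : FreeGroup X) := by
      simpa using h2
    exact QuotientGroup.eq.1 h3
  refine hc (Finsupp.mapDomain_injOn (M := ZMod p) _ hinj (x₁ := c) (x₂ := 0) ?_ ?_ ?_)
  · simp
  · simp
  · simpa using hzero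

/-- Below any `p`-open subgroup there is one at which the order of `x` has not grown yet, but
grows in the mod `p` Fox extension. -/
theorem exists_isPOpen_fox_chain_pow_ne_zero [hp : Fact p.Prime] [Finite X]
    {K₀ : Subgroup (FreeGroup X)} (hK₀ : IsPOpen p K₀) {u : FreeGroup X} (hu : u ∈ K₀)
    (hu1 : u ≠ 1) :
    ∃ (K : Subgroup (FreeGroup X)) (_ : K.Normal), IsPOpen p K ∧ K ≤ K₀ ∧ u ∈ K ∧
      (fox p (QuotientGroup.mk' K) u).chain ≠ 0 := by
  obtain ⟨L, hL, huL⟩ := exists_isPOpen_notMem (p := p) hu1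
  have := hL.normal
  have := hL.finiteIndex
  -- Minimality of the image modulo `L` replaces a descending chain argument: if the chain of `u`
  -- vanished, the Fox kernel of the minimal `K` would be another candidate, hence would have the
  -- same image `J`. But a map of `J` onto `ℤ/p`, pulled back to `K`, must vanish on the Fox kernel.
  let size (K : Subgroup (FreeGroup X)) : ℕ := Nat.card (K.map (QuotientGroup.mk' L))
  let S : Set (Subgroup (FreeGroup X)) := {K | IsPOpen p K ∧ K ≤ K₀ ∧ u ∈ K}
  have hS : S.Nonempty := ⟨K₀, hK₀, le_rfl, hu⟩
  obtain ⟨hK, hKK₀, huK⟩ := Function.argminOn_mem size S hS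
  have hmin (K') (hK' : K' ∈ S) := Function.argminOn_le size S hK'
  set K := Function.argminOn size S hS
  have hKn := hK.normal
  refine ⟨K, hKn, hK, hKK₀, huK, fun h0 => ?_⟩
  let K' := (fox p (QuotientGroup.mk' K)).ker
  have huK' : u ∈ K' := by
    rw [MonoidHom.mem_ker]
    ext1
    · exact h0
    · rw [fox_base]
      exact (QuotientGroup.eq_one_iff u).2 huK
  let J := K.map (QuotientGroup.mk' L)
  have huJ : (u : FreeGroup X ⧸ L) ∈ J := ⟨u, huK, rfl⟩
  have : Nontrivial J := ⟨⟨u, huJ⟩, 1, fun h =>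
    huL ((QuotientGroup.eq_one_iff u).1 (congrArg Subtype.val h))⟩
  obtain ⟨ψ, hψ⟩ := (hL.isPGroup_quotient.to_subgroup J).exists_surjective_zmod
  obtain ⟨j, hj⟩ := hψ (Multiplicative.ofAdd 1)
  have hle : K'.map (QuotientGroup.mk' L) ≤ J := Subgroup.map_mono (ker_fox_le K)
  have hJ : K'.map (QuotientGroup.mk' L) = J :=
    Subgroup.eq_of_le_of_card_ge hle (hmin K' ⟨isPOpen_ker_fox hK, (ker_fox_le K).trans hKK₀, huK'⟩)
  obtain ⟨w, hw, hwj⟩ : (j : FreeGroup X ⧸ L) ∈ K'.map (QuotientGroup.mk' L) := by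
    rw [hJ]; exact j.2
  refine fox_mk'_chain_ne_zero K (ψ.comp ((QuotientGroup.mk' L).subgroupMap K))
    ⟨w, ker_fox_le K hw⟩ ?_ ?_
  · have : (QuotientGroup.mk' L).subgroupMap K ⟨w, ker_fox_le K hw⟩ = j := Subtype.ext hwj
    rw [MonoidHom.comp_apply, this, hj]
    simp
  · rw [MonoidHom.mem_ker.1 hw, one_chain]

/-- The group elements occurring in the Fox derivatives of `w`. -/
noncomputable def foxSupport (p : ℕ) (w : FreeGroup X) : Set (FreeGroup X) :=
  Prod.snd '' ((fox p (MonoidHom.id (FreeGroup X)) w).chain.support : Set (X × FreeGroup X))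

theorem finite_foxSupport (w : FreeGroup X) : (foxSupport p w).Finite :=
  (Finset.finite_toSet _).image _

/-- Chains over quotients are pushforwards of the chain over the free group itself, so one finite
set bounds the support for all quotients at once. -/
theorem exists_foxSupport_of_chain_ne_zero {Q : Type*} [Group Q] (π : FreeGroup X →* Q)
    (w : FreeGroup X) (a : X) (r : Q) (h : (fox p π w).chain (a, r) ≠ 0) :
    ∃ v ∈ foxSupport p w, r = π v := by
  classical
  have hc := fox_comp (p := p) (MonoidHom.id (FreeGroup X)) π w
  rw [MonoidHom.comp_id] at hc
  rw [hc] at h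
  have := Finsupp.mapDomain_support (Finsupp.mem_support_iff.2 h)
  obtain ⟨⟨b, v⟩, hv, he⟩ := Finset.mem_image.1 this
  exact ⟨v, ⟨(b, v), hv, rfl⟩, ((Prod.ext_iff.1 he).2).symm⟩

/-- The path of `w ^ n` is a concatenation of translates of the path of `w` by powers of `π w`; the
bound on the support is thus uniform in `n`. -/
theorem exists_foxSupport_of_chain_pow_ne_zero {Q : Type*} [Group Q] (π : FreeGroup X →* Q)
    (w : FreeGroup X) (n : ℕ) (a : X) (r : Q) (h : (fox p π (w ^ n)).chain (a, r) ≠ 0) :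
    ∃ v ∈ foxSupport p w, ∃ i : ℕ, r = π w ^ i * π v := by
  induction n with
  | zero => simp at h
  | succ n ih =>
    rw [pow_succ, _root_.map_mul, mul_chain, Finsupp.add_apply, fox_base, shift_apply] at h
    by_cases h1 : (fox p π (w ^ n)).chain (a, r) = 0
    · rw [h1, zero_add] at h
      obtain ⟨v, hv, hr⟩ := exists_foxSupport_of_chain_ne_zero π w a _ h
      refine ⟨v, hv, n, ?_⟩
      rw [← hr, _root_.map_pow, mul_inv_cancel_left]
    · exact ih h1

/-- Free groups of finite rank are `p`-conjugacy separable. -/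
theorem isPConjugacySeparable [hp : Fact p.Prime] [Finite X] :
    IsPConjugacySeparable p (FreeGroup X) := by
  rw [isPConjugacySeparable_iff_exists_isPOpen]
  intro x y hxy
  by_cases hx : x = 1
  · subst hx
    have hy : y ≠ 1 := fun h => hxy (h ▸ IsConj.refl _)
    obtain ⟨K, hK, hyK⟩ := exists_isPOpen_notMem (p := p) hy
    exact ⟨K, hK, fun g => by simpa using hyK⟩
  by_contra! hcon
  -- The finitely many elements `v * u⁻¹` will be the only possible conjugators up to powers of `x`
  -- and `y`. None conjugates `x` to `y`, so residual `p`-finiteness excludes them all modulo one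
  -- `K₀`.
  let T : Finset (FreeGroup X × FreeGroup X) :=
    (finite_foxSupport (p := p) x).toFinset ×ˢ (finite_foxSupport (p := p) y).toFinset
  obtain ⟨K₀, hK₀, hT⟩ := IsPOpen.exists_forall_finset (p := p) T
    (fun i K => (i.2 * i.1⁻¹) * x * (i.2 * i.1⁻¹)⁻¹ * y⁻¹ ∉ K)
    (fun i K L hKL h hmem => h (hKL hmem))
    (fun i _ => exists_isPOpen_notMem fun h => hxy
      (isConj_iff.2 ⟨i.2 * i.1⁻¹, mul_inv_eq_one.1 h⟩))
  have := hK₀.normal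
  have := hK₀.finiteIndex
  obtain ⟨N, hN, hxN⟩ := (isOfFinOrder_of_finite (x : FreeGroup X ⧸ K₀)).exists_pow_eq_one
  rw [← QuotientGroup.mk_pow, QuotientGroup.eq_one_iff] at hxN
  have hxN1 : x ^ N ≠ 1 := by
    rw [Ne, pow_eq_one_iff_left hN.ne']
    exact hx
  obtain ⟨K, _, hK, hKK₀, hxK, hc⟩ := exists_isPOpen_fox_chain_pow_ne_zero hK₀ hxN hxN1
  obtain ⟨g, hg⟩ := hcon _ (isPOpen_ker_fox hK)
  set π := QuotientGroup.mk' K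
  rw [MonoidHom.mem_ker, _root_.map_mul, _root_.map_inv, mul_inv_eq_one] at hg
  -- Since `x ^ N` has trivial base, conjugation by `g` merely translates its chain.
  have hgN : (fox p π (y ^ N)).chain = shift (π g) (fox p π (x ^ N)).chain := by
    have h1 : fox p π (y ^ N) = fox p π g * fox p π (x ^ N) * (fox p π g)⁻¹ := by
      rw [_root_.map_pow, ← hg, _root_.map_mul, _root_.map_mul, _root_.map_inv, conj_pow, _root_.map_pow]
    rw [h1, conj_chain_of_base_eq_one, fox_base]
    rw [fox_base]
    exact (QuotientGroup.eq_one_iff _).2 hxK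
  -- A vertex `x ^ j * u` in the support of the first chain is carried by `g` to a vertex `y ^ i *
  -- v` of the second. Hence `g` is `y ^ i * v * u⁻¹ * x ^ (-j)` modulo `K`.
  obtain ⟨⟨a, r⟩, har⟩ := Finsupp.ne_iff.1 hc
  obtain ⟨u, hu, j, hr⟩ := exists_foxSupport_of_chain_pow_ne_zero π x N a r har
  obtain ⟨v, hv, i, hqr⟩ := exists_foxSupport_of_chain_pow_ne_zero (p := p) π y N a (π g * r) (by
    rw [hgN, shift_apply, inv_mul_cancel_left]
    exact har)
  have hπ : π g * π x * (π g)⁻¹ = π y := by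
    simpa using congrArg CayleyChainExtension.base hg
  have hgx : π g = π y ^ i * π v * (π u)⁻¹ * (π x ^ j)⁻¹ := by
    rw [hr] at hqr
    rw [← hqr]
    group
  refine hT (u, v) (by simp [T, hu, hv]) (hKK₀ ((QuotientGroup.eq_one_iff _).1 ?_))
  change π _ = 1
  have ht : π (v * u⁻¹) = (π y ^ i)⁻¹ * π g * π x ^ j := by
    rw [hgx, _root_.map_mul, _root_.map_inv]
    group
  have hc1 : π x ^ j * π x * (π x ^ j)⁻¹ = π x := by group
  have hc2 : (π y ^ i)⁻¹ * π y * π y ^ i = π y := by group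
  rw [_root_.map_mul, _root_.map_mul, _root_.map_mul, _root_.map_inv, _root_.map_inv, mul_inv_eq_one, ht]
  calc (π y ^ i)⁻¹ * π g * π x ^ j * π x * ((π y ^ i)⁻¹ * π g * π x ^ j)⁻¹
      = (π y ^ i)⁻¹ * (π g * (π x ^ j * π x * (π x ^ j)⁻¹) * (π g)⁻¹) * π y ^ i := by group
    _ = π y := by rw [hc1, hπ, hc2]

end FreeGroup

/-! ### Finite rank, and centralizers in finite `p`-quotients. -/

theorem FreeGroup.finite_of_fg {X : Type*} (h : Group.FG (FreeGroup X)) : Finite X := by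
  have h1 : Group.FG (Abelianization (FreeGroup X)) :=
    Group.fg_of_surjective (f := Abelianization.of) (QuotientGroup.mk'_surjective _)
  have h2 : AddGroup.FG (FreeAbelianGroup X) := GroupFG.iff_add_fg.1 h1
  have h3 : Module.Finite ℤ (FreeAbelianGroup X) := Module.Finite.iff_addGroup_fg.2 h2
  exact Module.Finite.finite_basis (FreeAbelianGroup.basis X)

theorem IsFreeGroup.finite_generators {F : Type*} [Group F] [IsFreeGroup F] [h : Group.FG F] :
    Finite (IsFreeGroup.Generators F) :=
  FreeGroup.finite_of_fg (Group.fg_of_surjective (f := (IsFreeGroup.toFreeGroup F).toMonoidHom)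
    (IsFreeGroup.toFreeGroup F).surjective)

theorem IsFreeGroup.isPConjugacySeparable {p : ℕ} [hp : Fact p.Prime] {F : Type*} [Group F]
    [IsFreeGroup F] [Group.FG F] : IsPConjugacySeparable p F := by
  have := IsFreeGroup.finite_generators (F := F)
  exact FreeGroup.isPConjugacySeparable.of_mulEquiv (IsFreeGroup.toFreeGroup F).symm

/-- A `p`-open subgroup of a subgroup containing a `p`-open subgroup contains a `p`-open subgroup. -/
theorem IsPOpen.exists_le_map_subtype {p : ℕ} {G : Type*} [Group G] {L M : Subgroup G}
    (hL : IsPOpen p L) (hLM : L ≤ M) {K : Subgroup M} (hK : IsPOpen p K) :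
    ∃ K', IsPOpen p K' ∧ K' ≤ L ∧ K' ≤ K.map M.subtype := by
  have := hL.normal
  have := hL.finiteIndex
  have := hK.finiteIndex
  have hMfin : M.FiniteIndex := Subgroup.finiteIndex_of_le hLM
  have hKfin : (K.map M.subtype).FiniteIndex := by
    refine ⟨?_⟩
    rw [Subgroup.index_map_subtype]
    exact mul_ne_zero hK.finiteIndex.index_ne_zero hMfin.index_ne_zero
  obtain ⟨e, he⟩ := hK.exists_uniform_pow_mem
  refine ⟨(L ⊓ K.map M.subtype).normalCore, ⟨inferInstance, inferInstance, fun g => ?_⟩,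
    (Subgroup.normalCore_le _).trans inf_le_left, (Subgroup.normalCore_le _).trans inf_le_right⟩
  obtain ⟨k, hk⟩ := hL.exists_pow_mem g
  refine ⟨k + e, fun t => ?_⟩
  have h1 : t * g ^ p ^ k * t⁻¹ ∈ L := hL.normal.conj_mem _ hk t
  have h2 : t * g ^ p ^ (k + e) * t⁻¹ = (t * g ^ p ^ k * t⁻¹) ^ p ^ e := by
    rw [conj_pow, pow_add, pow_mul]
  rw [h2]
  exact ⟨L.pow_mem h1 _, ⟨_, he ⟨_, hLM h1⟩, rfl⟩⟩

/-- Centralizers of elements in finite `p`-quotients of a free group are, up to a prescribed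
`p`-open subgroup, images of centralizers. -/
theorem IsFreeGroup.exists_isPOpen_centralizer {p : ℕ} [hp : Fact p.Prime] {F : Type*} [Group F]
    [IsFreeGroup F] [Group.FG F] {L : Subgroup F} (hL : IsPOpen p L) (x : F) :
    ∃ K, IsPOpen p K ∧ K ≤ L ∧ ∀ c, c * x * c⁻¹ * x⁻¹ ∈ K → ∃ d, Commute d x ∧ c⁻¹ * d ∈ L := by
  classical
  have := hL.normal
  have := hL.finiteIndex
  have := Fintype.ofFinite (F ⧸ L)
  -- Separability is applied in `M`, not in `F`: an element of `M` conjugating `c * x * c⁻¹` to `x`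
  -- is a power of `x` times an element of `L`, and dropping the power leaves a centralizing element
  -- in the coset of `c`.
  let M := L ⊔ Subgroup.zpowers x
  have hLM : L ≤ M := le_sup_left
  have hxM : x ∈ M := Subgroup.mem_sup_right (Subgroup.mem_zpowers x)
  have : M.FiniteIndex := Subgroup.finiteIndex_of_le hLM
  have hsep : IsPConjugacySeparable p M := IsFreeGroup.isPConjugacySeparable
  rw [isPConjugacySeparable_iff_exists_isPOpen] at hsep
  obtain ⟨K, hK, hKc⟩ := IsPOpen.exists_forall_finset (p := p) (Finset.univ : Finset (F ⧸ L))
    (fun q K => ∀ c : F, (c : F ⧸ L) = q → (∀ d, Commute d x → c⁻¹ * d ∉ L) →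
      c * x * c⁻¹ * x⁻¹ ∉ K)
    (fun q K K' hKK' h c hc hd hmem => h c hc hd (hKK' hmem)) (by
      intro q _
      obtain ⟨c, rfl⟩ := QuotientGroup.mk_surjective q
      by_cases hbad : ∀ d, Commute d x → c⁻¹ * d ∉ L
      swap
      · push Not at hbad
        obtain ⟨d, hd, hcd⟩ := hbad
        refine ⟨⊤, IsPOpen.top, fun c' hc' hbad' => (hbad' d hd ?_).elim⟩
        have := L.mul_mem (QuotientGroup.eq.1 hc') hcd
        rwa [mul_assoc, mul_inv_cancel_left] at this
      by_cases hcM : c * x * c⁻¹ ∈ M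
      swap
      · refine ⟨L, hL, fun c' hc' _ hmem => hcM ?_⟩
        have h1 : c' * x * c'⁻¹ ∈ M := by
          have := M.mul_mem (hLM hmem) hxM
          rwa [inv_mul_cancel_right] at this
        have h2 : c * c'⁻¹ ∈ M := by
          have := hL.normal.mem_comm (QuotientGroup.eq.1 hc')
          exact hLM this
        have := M.mul_mem (M.mul_mem h2 h1) (M.inv_mem h2)
        convert this using 1
        group
      · obtain ⟨K, hK, hKg⟩ := hsep ⟨_, hcM⟩ ⟨x, hxM⟩ (by
          intro hconj
          obtain ⟨m, hm⟩ := isConj_iff.1 hconj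
          obtain ⟨l, hl, _, ⟨i, rfl⟩, hm'⟩ := Subgroup.mem_sup_of_normal_left.1 (M.inv_mem m.2)
          have h1 : (m : F) = (x ^ i)⁻¹ * l⁻¹ := by
            rw [← mul_inv_rev, hm', inv_inv]
          have h2 : (m : F) * (c * x * c⁻¹) * (m : F)⁻¹ = x := congrArg Subtype.val hm
          refine hbad (l⁻¹ * c) ?_ (by simpa [mul_assoc] using hL.normal.conj_mem _ (L.inv_mem hl) c⁻¹)
          rw [commute_iff_eq, ← mul_inv_eq_iff_eq_mul]
          rw [h1] at h2
          calc l⁻¹ * c * x * (l⁻¹ * c)⁻¹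
              = x ^ i * ((x ^ i)⁻¹ * l⁻¹ * (c * x * c⁻¹) * ((x ^ i)⁻¹ * l⁻¹)⁻¹) * (x ^ i)⁻¹ := by
                group
            _ = x := by rw [h2]; group)
        obtain ⟨K', hK', hK'L, hK'K⟩ := hL.exists_le_map_subtype hLM hK
        refine ⟨K', hK', fun c' hc' _ hmem => ?_⟩
        have h2 : c' * c⁻¹ ∈ M :=
          hLM (by simpa using hL.normal.mem_comm (QuotientGroup.eq.1 hc'.symm))
        obtain ⟨w, hw, hwe⟩ := hK'K hmem
        refine hKg ⟨_, h2⟩ ?_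
        have hwe' : (w : F) = c' * x * c'⁻¹ * x⁻¹ := hwe
        convert (SetLike.mem_coe.1 hw) using 1
        ext
        simp only [Subgroup.coe_mul, Subgroup.coe_inv, hwe']
        group)
  refine ⟨K ⊓ L, hK.inf hL, inf_le_right, fun c hc => ?_⟩
  by_contra! hcon
  exact hKc c (Finset.mem_univ _) c rfl hcon hc.1

/-! ### Reduced words: elements that are not proper powers, and commutation. -/

namespace FreeGroup

variable {X : Type*}

open List

/-- A cyclically reduced word with a single longest run of one letter is not a proper power. -/
theorem pow_ne_of_unique_run {a : X} {A : ℕ} {T : List (X × Bool)}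
    (hL : IsCyclicallyReduced (replicate A (a, true) ++ T))
    (hT : ¬ replicate A (a, true) <:+: T) {s : X × Bool} (hs : s ∈ T) (hsa : s ≠ (a, true))
    (z : FreeGroup X) {k : ℕ} (hk : 2 ≤ k) : z ^ k ≠ mk (replicate A (a, true) ++ T) := by
  classical
  intro hz
  have hA : A ≠ 0 := by
    rintro rfl
    exact hT ⟨[], T, by simp⟩
  set L := replicate A (a, true) ++ T with hLdef
  have hw : toWord (z ^ k) = L := by
    rw [hz, toWord_mk, hL.isReduced.reduce_eq]
  rw [toWord_pow, reduceCyclically.reduce_flatten_replicate isReduced_toWord, if_neg (by omega)] at hw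
  have hconj : reduceCyclically.conjugator z.toWord = [] := by
    by_contra hne
    obtain ⟨c, C, hc⟩ := List.exists_cons_of_ne_nil hne
    rw [hc] at hw
    have hhead : L.head? = some c := by rw [← hw]; simp
    have hlast : L.getLast? = some (c.1, !c.2) := by
      have : L = (c :: C ++ (replicate k (reduceCyclically z.toWord)).flatten ++ invRev C) ++
          [(c.1, !c.2)] := by
        rw [← hw]; simp [invRev]
      rw [this, List.getLast?_concat]
    have := hL.2 _ hlast _ hhead rfl
    simp at this
  rw [hconj] at hw
  simp only [nil_append, invRev, List.map_nil, reverse_nil, append_nil] at hw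
  set l := reduceCyclically z.toWord
  obtain ⟨m, rfl⟩ : ∃ m, k = m + 2 := ⟨k - 2, by omega⟩
  rw [replicate_succ, flatten_cons, hLdef] at hw
  -- The word is now `l` repeated at least twice. A long `l` starts with the run, so its second copy
  -- puts the run inside `T`; a short `l` lies inside the run, so the letter `s` cannot occur.
  rcases le_total A l.length with hAl | hlA
  · have h1 : replicate A (a, true) <+: l := by
      refine List.prefix_of_prefix_length_le (l₃ := replicate A (a, true) ++ T)
        (List.prefix_append _ _) ?_ (by simpa using hAl)
      rw [← hw]; exact List.prefix_append _ _
    obtain ⟨l', hl'⟩ := h1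
    rw [replicate_succ, flatten_cons] at hw
    apply hT
    refine ⟨l', l' ++ (replicate m l).flatten, ?_⟩
    have h2 : replicate A (a, true) ++ (l' ++ (replicate A (a, true) ++ (l' ++ (replicate m l).flatten)))
        = replicate A (a, true) ++ T := by
      rw [← hw, ← hl']; simp
    have := List.append_cancel_left h2
    rw [← this]; simp
  · have h1 : l <+: replicate A (a, true) := by
      refine List.prefix_of_prefix_length_le (l₃ := replicate A (a, true) ++ T) ?_
        (List.prefix_append _ _) (by simpa using hlA)
      rw [← hw]; exact List.prefix_append _ _
    have h2 : ∀ t ∈ l, t = (a, true) := fun t ht => List.eq_of_mem_replicate (h1.subset ht)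
    have h3 : s ∈ l ++ (replicate (m + 1) l).flatten := by
      rw [hw]; exact List.mem_append_right _ hs
    rcases List.mem_append.1 h3 with h | h
    · exact hsa (h2 _ h)
    · obtain ⟨l', hl', hsl'⟩ := List.mem_flatten.1 h
      rw [List.eq_of_mem_replicate hl'] at hsl'
      exact hsa (h2 _ hsl')

theorem toWord_of_zpow [DecidableEq X] (a : X) (i : ℤ) :
    (of a ^ i).toWord = replicate i.natAbs (a, decide (0 ≤ i)) := by
  obtain ⟨n, rfl | rfl⟩ := i.eq_nat_or_neg
  · simp [toWord_of_pow]
  · rcases Nat.eq_zero_or_pos n with rfl | hn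
    · simp
    · have : ¬ n = 0 := by omega
      simp [toWord_of_pow, toWord_inv, invRev, this]

/-- Every element outside `⟨a⟩` is, up to multiplication by powers of `a` on both sides, a word that
neither starts nor ends with `a` or its inverse. -/
theorem exists_eq_zpow_mul_mul_zpow [DecidableEq X] (a : X) (g : FreeGroup X)
    (hg : g ∉ Subgroup.zpowers (of a)) :
    ∃ (r s : ℤ) (h : FreeGroup X), g = of a ^ r * h * of a ^ s ∧ h.toWord ≠ [] ∧
      (∀ t ∈ h.toWord.head?, t.1 ≠ a) ∧ (∀ t ∈ h.toWord.getLast?, t.1 ≠ a) := by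
  let S : Set (FreeGroup X) := {h | ∃ r s : ℤ, g = of a ^ r * h * of a ^ s}
  have hS : S.Nonempty := ⟨g, 0, 0, by simp⟩
  obtain ⟨r, s, hrs⟩ := Function.argminOn_mem norm S hS
  have hmin (k) (hk : k ∈ S) : norm (Function.argminOn norm S hS) ≤ norm k :=
    Function.argminOn_le norm S hk
  set h := Function.argminOn norm S hS
  have hof (ε : Bool) : ∃ i : ℤ, of a ^ i = mk [(a, ε)] := by
    cases ε
    · exact ⟨-1, by simp [of, inv_mk, invRev]⟩
    · exact ⟨1, by simp [of]⟩
  refine ⟨r, s, h, hrs, fun h0 => hg ?_, ?_, ?_⟩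
  · rw [toWord_eq_nil_iff] at h0
    rw [h0, mul_one, ← zpow_add] at hrs
    exact ⟨r + s, hrs.symm⟩
  · rintro ⟨b, ε⟩ ht rfl
    obtain ⟨W, hW⟩ := List.head?_eq_some_iff.1 ht
    obtain ⟨i, hi⟩ := hof ε
    have hh : h = of b ^ i * mk W := by
      rw [hi, mul_mk, singleton_append, ← hW, mk_toWord]
    have h1 := hmin (mk W) ⟨r + i, s, by rw [hrs, hh, zpow_add]; simp [mul_assoc]⟩
    have h2 : norm (mk W) ≤ W.length := norm_mk_le
    have h3 : norm h = W.length + 1 := by rw [norm, hW]; simp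
    omega
  · rintro ⟨b, ε⟩ ht rfl
    obtain ⟨W, hW⟩ := List.getLast?_eq_some_iff.1 ht
    obtain ⟨i, hi⟩ := hof ε
    have hh : h = mk W * of b ^ i := by
      rw [hi, mul_mk, ← hW, mk_toWord]
    have h1 := hmin (mk W) ⟨r, i + s, by rw [hrs, hh, zpow_add]; simp [mul_assoc]⟩
    have h2 : norm (mk W) ≤ W.length := norm_mk_le
    have h3 : norm h = W.length + 1 := by rw [norm, hW]; simp
    omega

/-- Only powers of `a` commute with the generator `a`. -/
theorem mem_zpowers_of_commute_of (a : X) (g : FreeGroup X) (h : Commute g (of a)) :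
    g ∈ Subgroup.zpowers (of a) := by
  classical
  by_contra hg
  obtain ⟨r, s, w, hw, hne, hhead, hlast⟩ := exists_eq_zpow_mul_mul_zpow a g hg
  have hcomm : of a * w = w * of a := by
    have h1 : w = (of a ^ r)⁻¹ * g * (of a ^ s)⁻¹ := by rw [hw]; group
    have h2 : Commute w (of a) := by
      rw [h1]
      exact (((Commute.refl _).zpow_left r).inv_left.mul_left h).mul_left
        ((Commute.refl _).zpow_left s).inv_left
    exact h2.eq.symm
  obtain ⟨c, W, hW⟩ := List.exists_cons_of_ne_nil hne
  have hca : c.1 ≠ a := hhead c (by simp [hW])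
  have h1 : (of a * w).toWord = (a, true) :: w.toWord := by
    rw [toWord_mul, toWord_of, singleton_append]
    refine IsReduced.reduce_eq ?_
    rw [hW, isReduced_cons_cons, ← hW]
    exact ⟨fun h => (hca h.symm).elim, isReduced_toWord⟩
  have h2 : (w * of a).toWord <+ w.toWord ++ [(a, true)] := by
    simpa using toWord_mul_sublist w (of a)
  rw [← hcomm, h1] at h2
  have h3 := h2.eq_of_length (by simp)
  rw [hW] at h3
  exact hca (by simpa using (congrArg Prod.fst (List.cons.inj h3).1).symm)

end FreeGroup

namespace FreeGroup

variable {X : Type*}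

open List

theorem IsReduced.append_of_ne {L₁ L₂ : List (X × Bool)} (h₁ : IsReduced L₁) (h₂ : IsReduced L₂)
    (h : ∀ s ∈ L₁.getLast?, ∀ t ∈ L₂.head?, s.1 ≠ t.1) : IsReduced (L₁ ++ L₂) :=
  List.isChain_append.2 ⟨h₁, h₂, fun s hs t ht hst => (h s hs t ht hst).elim⟩

theorem isReduced_replicate (n : ℕ) (t : X × Bool) : IsReduced (replicate n t) :=
  List.isChain_replicate_of_rel _ fun _ => rfl

/-- Every element outside `⟨b⟩` has a conjugate by a power of `b` whose word begins and ends with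
`b` or its inverse. -/
theorem exists_conj_zpow_toWord [DecidableEq X] (b : X) (g : FreeGroup X)
    (hg : g ∉ Subgroup.zpowers (of b)) :
    ∃ i : ℤ, (of b ^ i * g * (of b ^ i)⁻¹).toWord ≠ [] ∧
      (∀ t ∈ (of b ^ i * g * (of b ^ i)⁻¹).toWord.head?, t.1 = b) ∧
      (∀ t ∈ (of b ^ i * g * (of b ^ i)⁻¹).toWord.getLast?, t.1 = b) := by
  obtain ⟨r, s, h, hrs, hne, hhead, hlast⟩ := exists_eq_zpow_mul_mul_zpow b g hg
  obtain ⟨i, hi1, hi2⟩ : ∃ i : ℤ, i + r ≠ 0 ∧ s - i ≠ 0 :=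
    ⟨|r| + |s| + 1, by have := neg_abs_le r; have := abs_nonneg s; omega,
      by have := le_abs_self s; have := abs_nonneg r; omega⟩
  have heq : of b ^ i * g * (of b ^ i)⁻¹ = of b ^ (i + r) * h * of b ^ (s - i) := by
    rw [hrs]; group
  have hword : (of b ^ i * g * (of b ^ i)⁻¹).toWord =
      (of b ^ (i + r)).toWord ++ h.toWord ++ (of b ^ (s - i)).toWord := by
    rw [heq]
    have hred : IsReduced ((of b ^ (i + r)).toWord ++ h.toWord ++ (of b ^ (s - i)).toWord) := by
      refine IsReduced.append_of_ne (IsReduced.append_of_ne isReduced_toWord isReduced_toWord ?_)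
        isReduced_toWord ?_
      · intro u hu t ht
        rw [toWord_of_zpow] at hu
        have := List.eq_of_mem_replicate (List.mem_of_getLast? hu)
        rw [this]
        exact (hhead t ht).symm
      · intro u hu t ht
        rw [List.getLast?_append_of_ne_nil _ hne] at hu
        rw [toWord_of_zpow] at ht
        have := List.eq_of_mem_replicate (List.mem_of_head? ht)
        rw [this]
        exact hlast u hu
    rw [← hred.reduce_eq, ← toWord_mk, ← mul_mk, ← mul_mk, mk_toWord, mk_toWord, mk_toWord]
  have hn1 : (of b ^ (i + r)).toWord ≠ [] := by rw [toWord_of_zpow]; simpa using hi1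
  have hn2 : (of b ^ (s - i)).toWord ≠ [] := by rw [toWord_of_zpow]; simpa using hi2
  refine ⟨i, ?_, ?_, ?_⟩
  · rw [hword]; simp [hn1]
  · intro t ht
    rw [hword, append_assoc, List.head?_append_of_ne_nil _ hn1, toWord_of_zpow] at ht
    rw [List.eq_of_mem_replicate (List.mem_of_head? ht)]
  · intro t ht
    rw [hword, List.getLast?_append_of_ne_nil _ hn2, toWord_of_zpow] at ht
    rw [List.eq_of_mem_replicate (List.mem_of_getLast? ht)]

theorem eq_zero_of_zpow_mem_zpowers {a b : X} (hab : a ≠ b) {i : ℤ}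
    (h : of a ^ i ∈ Subgroup.zpowers (of b)) : i = 0 := by
  classical
  obtain ⟨j, hj⟩ := h
  let φ : FreeGroup X →* Multiplicative ℤ :=
    lift fun t => if t = a then Multiplicative.ofAdd 1 else 1
  have := congrArg φ hj
  simp only [φ, _root_.map_zpow, lift_apply_of, if_true, if_neg hab.symm, one_zpow] at this
  have := congrArg Multiplicative.toAdd this
  simpa using this.symm

/-- A nontrivial power of `b` leaves `⟨b⟩` when conjugated by `a`: otherwise exponent sums would
make it commute with `a`. -/
theorem exists_mem_notMem_zpowers {a b : X} (hab : a ≠ b) {N : Subgroup (FreeGroup X)}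
    [hN : N.Normal] (hbot : N ≠ ⊥) : ∃ n ∈ N, n ∉ Subgroup.zpowers (of b) := by
  obtain ⟨⟨n, hn⟩, hn1⟩ := N.ne_bot_iff_exists_ne_one.1 hbot
  replace hn1 : n ≠ 1 := fun h => hn1 (Subtype.ext h)
  by_cases hb : n ∈ Subgroup.zpowers (of b)
  swap
  · exact ⟨n, hn, hb⟩
  refine ⟨of a * n * (of a)⁻¹, hN.conj_mem n hn _, fun hmem => hn1 ?_⟩
  obtain ⟨i, rfl⟩ := hb
  obtain ⟨j, hj⟩ := hmem
  classical
  let φ : FreeGroup X →* Multiplicative ℤ :=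
    lift fun t => if t = b then Multiplicative.ofAdd 1 else 1
  have hji : j = i := by
    have := congrArg φ hj
    simp only [φ, _root_.map_zpow, _root_.map_mul, _root_.map_inv, lift_apply_of, if_true,
      if_neg hab, one_mul, inv_one, mul_one] at this
    simpa using congrArg Multiplicative.toAdd this
  subst hji
  have hcomm : Commute (of b ^ j) (of a) := by
    rw [commute_iff_eq, ← eq_mul_inv_iff_mul_eq.1 hj]
  rw [eq_zero_of_zpow_mem_zpowers hab.symm (mem_zpowers_of_commute_of a _ hcomm)]
  simp

theorem infix_of_infix_append_cons {α : Type*} {l l₁ l₂ : List α} {c : α}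
    (h : l <:+: l₁ ++ c :: l₂) (hc : c ∉ l) : l <:+: l₁ ∨ l <:+: l₂ := by
  obtain ⟨s, e, h⟩ := h
  rcases List.append_eq_append_iff.1 h with ⟨d, rfl, -⟩ | ⟨d, hd, hde⟩
  · exact .inl ⟨s, d, rfl⟩
  cases d with
  | nil => exact .inl ⟨s, [], by simpa using hd⟩
  | cons c' d =>
    obtain ⟨rfl, rfl⟩ := List.cons.inj hde
    rcases List.append_eq_append_iff.1 hd with ⟨b, -, rfl⟩ | ⟨b, -, hb⟩
    · exact (hc (by simp)).elim
    cases b with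
    | nil => exact (hc (by simp [← (show c :: d = l by simpa using hb)])).elim
    | cons c' b =>
      obtain ⟨rfl, rfl⟩ := List.cons.inj hb
      exact .inr ⟨b, e, rfl⟩

/-- Every coset of a nontrivial normal subgroup of a nonabelian free group contains an element that
is not a proper power. -/
theorem exists_mem_forall_pow_ne {a b : X} (hab : a ≠ b) {N : Subgroup (FreeGroup X)}
    [hN : N.Normal] (hbot : N ≠ ⊥) (f : FreeGroup X) :
    ∃ n ∈ N, ∀ (z : FreeGroup X) (k : ℕ), 2 ≤ k → z ^ k ≠ f * n := by
  classical
  obtain ⟨n, hn, hnb⟩ := exists_mem_notMem_zpowers hab hbot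
  obtain ⟨m, hm, hfm⟩ : ∃ m ∈ N, f * m ∉ Subgroup.zpowers (of b) := by
    by_cases hf : f ∈ Subgroup.zpowers (of b)
    · exact ⟨n, hn, fun h => hnb ((Subgroup.mul_mem_cancel_left _ hf).1 h)⟩
    · exact ⟨1, N.one_mem, by simpa using hf⟩
  obtain ⟨i, hu0, hu1, hu2⟩ := exists_conj_zpow_toWord b n hnb
  obtain ⟨j, hv0, hv1, hv2⟩ := exists_conj_zpow_toWord b (f * m) hfm
  set u := of b ^ i * n * (of b ^ i)⁻¹ with hu
  set v := of b ^ j * (f * m) * (of b ^ j)⁻¹ with hv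
  have huN : u ∈ N := hN.conj_mem n hn _
  -- Longer than `u` and `v` together, so that in `a ^ A * u * a ^ (-A) * v` the positive run of
  -- length `A` occurs only at the start.
  let A := u.toWord.length + v.toWord.length + 1
  let T := u.toWord ++ (replicate A (a, false) ++ v.toWord)
  have hra : ∀ (ε : Bool) (t : X × Bool), t ∈ replicate A (a, ε) → t.1 = a := fun ε t ht => by
    rw [List.eq_of_mem_replicate ht]
  have hAn (ε : Bool) : replicate A (a, ε) ≠ [] := by simp [A]
  have hTred : IsReduced (replicate A (a, true) ++ T) := by
    refine IsReduced.append_of_ne (isReduced_replicate _ _) (IsReduced.append_of_ne isReduced_toWord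
      (IsReduced.append_of_ne (isReduced_replicate _ _) isReduced_toWord ?_) ?_) ?_
    · intro s hs t ht
      rw [hra _ _ (List.mem_of_getLast? hs), hv1 t ht]
      exact hab
    · intro s hs t ht
      rw [List.head?_append_of_ne_nil _ (hAn _)] at ht
      rw [hra _ _ (List.mem_of_head? ht), hu2 s hs]
      exact hab.symm
    · intro s hs t ht
      rw [List.head?_append_of_ne_nil _ hu0] at ht
      rw [hra _ _ (List.mem_of_getLast? hs), hu1 t ht]
      exact hab
  have hTcyc : IsCyclicallyReduced (replicate A (a, true) ++ T) := by
    refine ⟨hTred, fun s hs t ht hst => ?_⟩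
    rw [List.getLast?_append_of_ne_nil _ (by simp [T, hu0]), List.getLast?_append_of_ne_nil _
      (by simp [hv0]), List.getLast?_append_of_ne_nil _ hv0] at hs
    rw [List.head?_append_of_ne_nil _ (hAn _)] at ht
    rw [hra _ _ (List.mem_of_head? ht), hv2 s hs] at hst
    exact (hab hst.symm).elim
  have hTinf : ¬ replicate A (a, true) <:+: T := by
    intro hinf
    have hA0 : replicate A (a, false) = (a, false) :: replicate (A - 1) (a, false) := by
      rw [← replicate_succ]; congr 1
    simp only [T] at hinf
    rw [hA0, cons_append] at hinf
    have hlen {l : List (X × Bool)} (h : replicate A (a, true) <:+: l) : A ≤ l.length := by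
      simpa using h.length_le
    rcases infix_of_infix_append_cons hinf (by simp) with h | h
    · have := hlen h
      omega
    · have hA1 : ∀ B, ¬ replicate A (a, true) <:+: replicate B (a, false) ++ v.toWord := by
        intro B
        induction B with
        | zero =>
          intro h
          have := hlen h
          simp only [replicate_zero, nil_append] at this
          omega
        | succ B ih =>
          intro h
          rw [replicate_succ (n := B), cons_append] at h
          rcases infix_of_infix_append_cons (l₁ := []) h (by simp) with h | h
          · have := hlen h
            simp [A] at this
          · exact ih h
      exact hA1 _ h
  have hpow := fun z k (hk : 2 ≤ k) => pow_ne_of_unique_run (s := (a, false)) hTcyc hTinf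
    (List.mem_append_right _ (List.mem_append_left _ (by simp [A]))) (by simp) z hk
  have hmk : mk (replicate A (a, true) ++ T) = of a ^ A * u * (of a ^ A)⁻¹ * v := by
    have h1 : mk (replicate A (a, true)) = of a ^ A := by
      rw [← toWord_of_pow, mk_toWord]
    have h2 : mk (replicate A (a, false)) = (of a ^ A)⁻¹ := by
      rw [← h1, inv_mk, invRev]
      simp
    rw [← mul_mk, ← mul_mk, ← mul_mk, h1, h2, mk_toWord, mk_toWord]
    simp [mul_assoc]
  set c := of b ^ j
  set d := of a ^ A
  -- The first factor of the long word lies in `N`, so after conjugation by `c` the word represents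
  -- the coset of `f`.
  have hw : c⁻¹ * (d * u * d⁻¹ * v) * c = f * (m * ((f * m)⁻¹ * (c⁻¹ * (d * u * d⁻¹) * c) * (f * m))) := by
    rw [hv]; group
  refine ⟨m * ((f * m)⁻¹ * (c⁻¹ * (d * u * d⁻¹) * c) * (f * m)), N.mul_mem hm ?_, fun z k hk hz => ?_⟩
  · have h1 := hN.conj_mem _ huN d
    have h2 := hN.conj_mem _ h1 c⁻¹
    have h3 := hN.conj_mem _ h2 (f * m)⁻¹
    simpa using h3
  · refine hpow (c * z * c⁻¹) k hk ?_
    rw [conj_pow, hz, ← hw, hmk]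
    group

/-- A nontrivial normal subgroup of a nonabelian free group is nonabelian. -/
theorem exists_not_commute_of_normal {a b : X} (hab : a ≠ b) {N : Subgroup (FreeGroup X)}
    [hN : N.Normal] (hbot : N ≠ ⊥) : ∃ u ∈ N, ∃ v ∈ N, ¬ Commute u v := by
  classical
  obtain ⟨n, hn, hnb⟩ := exists_mem_notMem_zpowers hab hbot
  obtain ⟨i, hu0, hu1, hu2⟩ := exists_conj_zpow_toWord b n hnb
  set u := of b ^ i * n * (of b ^ i)⁻¹
  have huN : u ∈ N := hN.conj_mem n hn _
  refine ⟨u, huN, of a * u * (of a)⁻¹, hN.conj_mem u huN _, fun hcomm => ?_⟩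
  have hr (ε : Bool) : IsReduced ((a, ε) :: u.toWord) := by
    refine IsReduced.append_of_ne (L₁ := [(a, ε)]) (by simp) isReduced_toWord ?_
    intro s hs t ht
    rw [hu1 t ht, show s = (a, ε) by simpa using hs.symm]
    exact hab
  have hr1 (ε ε' : Bool) : IsReduced ((a, ε) :: u.toWord ++ [(a, ε')]) := by
    refine IsReduced.append_of_ne (hr ε) (by simp) ?_
    intro s hs t ht
    rw [List.getLast?_cons_of_ne_nil hu0] at hs
    rw [hu2 s hs, show t = (a, ε') by simpa using ht.symm]
    exact hab.symm
  have hr2 : IsReduced (u.toWord ++ ((a, true) :: u.toWord ++ [(a, false)])) := by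
    refine IsReduced.append_of_ne isReduced_toWord (hr1 _ _) ?_
    intro s hs t ht
    rw [hu2 s hs, show t = (a, true) by simpa using ht.symm]
    exact hab.symm
  have hr3 : IsReduced ((a, true) :: u.toWord ++ ((a, false) :: u.toWord)) := by
    refine IsReduced.append_of_ne (hr _) (hr _) ?_
    intro s hs t ht
    rw [List.getLast?_cons_of_ne_nil hu0] at hs
    rw [hu2 s hs, show t = (a, false) by simpa using ht.symm]
    exact hab.symm
  have hinv : mk [(a, false)] = (of a)⁻¹ := by simp [of, inv_mk, invRev]
  have h2 : mk (u.toWord ++ ((a, true) :: u.toWord ++ [(a, false)])) = u * (of a * u * (of a)⁻¹) := by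
    rw [← mul_mk, ← mul_mk, ← singleton_append, ← mul_mk, mk_toWord, hinv]
    rfl
  have h3 : mk ((a, true) :: u.toWord ++ ((a, false) :: u.toWord)) = of a * u * (of a)⁻¹ * u := by
    rw [← mul_mk, ← singleton_append (x := (a, true)) (l := u.toWord), ← mul_mk,
      ← singleton_append (x := (a, false)) (l := u.toWord), ← mul_mk, mk_toWord, hinv]
    simp only [mul_assoc]
    rfl
  rw [hcomm.eq, ← h3] at h2
  have h4 := reduce.sound h2
  rw [hr2.reduce_eq, hr3.reduce_eq] at h4
  obtain ⟨c, W, hW⟩ := List.exists_cons_of_ne_nil hu0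
  have hcb : c.1 = b := hu1 c (by simp [hW])
  rw [hW] at h4
  have h5 := congrArg Prod.fst (List.cons.inj h4).1
  exact hab (h5.symm.trans hcb)

end FreeGroup

/-! ### Centralizers, and normal subgroups of infinite index. -/

theorem IsFreeGroup.isCyclic_of_subsingleton_generators {F : Type*} [Group F] [IsFreeGroup F]
    [Subsingleton (IsFreeGroup.Generators F)] : IsCyclic F := by
  have hcyc : IsCyclic (FreeGroup (IsFreeGroup.Generators F)) := by
    rcases isEmpty_or_nonempty (IsFreeGroup.Generators F) with h | ⟨⟨a⟩⟩
    · infer_instance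
    · have : Unique (IsFreeGroup.Generators F) := uniqueOfSubsingleton a
      exact isCyclic_of_surjective FreeGroup.mulEquivIntOfUnique.symm.toMonoidHom
        FreeGroup.mulEquivIntOfUnique.symm.surjective
  exact isCyclic_of_surjective (IsFreeGroup.toFreeGroup F).symm.toMonoidHom
    (IsFreeGroup.toFreeGroup F).symm.surjective

/-- Centralizers of nontrivial elements of free groups are cyclic. -/
theorem IsFreeGroup.exists_commute_mem_zpowers {F : Type*} [Group F] [IsFreeGroup F] {x : F}
    (hx : x ≠ 1) : ∃ z, Commute z x ∧ ∀ d, Commute d x → d ∈ Subgroup.zpowers z := by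
  let C : Subgroup F := Subgroup.centralizer {x}
  have hC {d : F} : d ∈ C ↔ Commute d x := by
    rw [Subgroup.mem_centralizer_singleton_iff]; rfl
  let e := IsFreeGroup.toFreeGroup C
  let x' : C := ⟨x, hC.2 (Commute.refl x)⟩
  have hx' (d : C) : Commute (e x') (e d) :=
    Commute.map (show Commute x' d from Subtype.ext (hC.1 d.2).eq.symm) e
  -- In the centralizer, itself a free group, `x` is central, so it is a power of every generator;
  -- two generators would force `x = 1`.
  have hsub : Subsingleton (IsFreeGroup.Generators C) := by
    by_contra hns
    rw [not_subsingleton_iff_nontrivial] at hns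
    obtain ⟨a, b, hab⟩ := hns
    have h (t) : e x' ∈ Subgroup.zpowers (FreeGroup.of t) :=
      FreeGroup.mem_zpowers_of_commute_of t _ (by simpa using hx' (e.symm (FreeGroup.of t)))
    obtain ⟨i, hi⟩ := h a
    have hi0 := FreeGroup.eq_zero_of_zpow_mem_zpowers hab (i := i) (by
      change (fun k : ℤ => FreeGroup.of a ^ k) i ∈ _
      rw [hi]; exact h b)
    have h1 : e x' = 1 := by rw [← hi, hi0]; simp
    rw [map_eq_one_iff e e.injective] at h1
    exact hx (congrArg Subtype.val h1)
  obtain ⟨g, hg⟩ := (IsFreeGroup.isCyclic_of_subsingleton_generators (F := C)).exists_generator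
  refine ⟨g, hC.1 g.2, fun d hd => ?_⟩
  obtain ⟨i, hi⟩ := hg ⟨d, hC.2 hd⟩
  exact ⟨i, by simpa using congrArg Subtype.val hi⟩

theorem IsFreeGroup.commute_of_commute {F : Type*} [Group F] [IsFreeGroup F] {x y z : F}
    (hx : x ≠ 1) (hy : Commute y x) (hz : Commute z x) : Commute y z := by
  obtain ⟨t, -, ht⟩ := IsFreeGroup.exists_commute_mem_zpowers hx
  obtain ⟨i, rfl⟩ := ht y hy
  obtain ⟨j, rfl⟩ := ht z hz
  exact (Commute.refl t).zpow_zpow i j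

instance IsFreeGroup.isMulTorsionFree {F : Type*} [Group F] [IsFreeGroup F] :
    IsMulTorsionFree F :=
  (IsFreeGroup.toFreeGroup F).injective.isMulTorsionFree (IsFreeGroup.toFreeGroup F).toMonoidHom

section InfiniteIndex

variable {F : Type*} [Group F] [IsFreeGroup F] {N : Subgroup F} [hN : N.Normal]

include hN in
-- In rank at most one the group is cyclic, and its nontrivial subgroups have finite index.
theorem IsFreeGroup.nontrivial_generators (hbot : N ≠ ⊥) (hidx : ¬ N.FiniteIndex) :
    Nontrivial (IsFreeGroup.Generators F) := by
  by_contra h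
  rw [not_nontrivial_iff_subsingleton] at h
  obtain ⟨z, hz⟩ := (IsFreeGroup.isCyclic_of_subsingleton_generators (F := F)).exists_generator
  obtain ⟨⟨n, hn⟩, hn1⟩ := N.ne_bot_iff_exists_ne_one.1 hbot
  obtain ⟨i, rfl⟩ := hz n
  have hi : i ≠ 0 := by
    rintro rfl
    exact hn1 (Subtype.ext (by simp))
  refine hidx ?_
  have hfin : IsOfFinOrder (z : F ⧸ N) :=
    isOfFinOrder_iff_zpow_eq_one.2 ⟨i, hi, by
      rw [← QuotientGroup.mk_zpow]; exact (QuotientGroup.eq_one_iff _).2 hn⟩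
  have hall : ∀ q : F ⧸ N, q ∈ Subgroup.zpowers (z : F ⧸ N) := by
    intro q
    obtain ⟨g, rfl⟩ := QuotientGroup.mk_surjective q
    obtain ⟨j, rfl⟩ := hz g
    exact ⟨j, rfl⟩
  have hfz : (Subgroup.zpowers (z : F ⧸ N) : Set (F ⧸ N)).Finite :=
    finite_zpowers.2 hfin
  have : Finite (F ⧸ N) := Set.finite_univ_iff.1 (hfz.subset fun q _ => hall q)
  exact Subgroup.finiteIndex_of_finite_quotient

/-- The centralizer is generated by a root of the element; when the element is not a proper power
the exponent can only be `1` or `-1`. -/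
theorem IsFreeGroup.exists_mem_commute_mem_zpowers (hbot : N ≠ ⊥) (hidx : ¬ N.FiniteIndex) (f : F) :
    ∃ n ∈ N, ∀ d, Commute d (f * n) → d ∈ Subgroup.zpowers (f * n) := by
  obtain ⟨a, b, hab⟩ := IsFreeGroup.nontrivial_generators hbot hidx
  let e := IsFreeGroup.toFreeGroup F
  have hN' : (N.map e.toMonoidHom).Normal := hN.map _ e.surjective
  have hbot' : N.map e.toMonoidHom ≠ ⊥ := fun h =>
    hbot ((Subgroup.map_eq_bot_iff_of_injective N e.injective).1 h)
  obtain ⟨_, ⟨n, hn, rfl⟩, hpow⟩ := FreeGroup.exists_mem_forall_pow_ne hab hbot' (e f)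
  replace hpow (z : F) (k : ℕ) (hk : 2 ≤ k) : z ^ k ≠ f * n := fun h =>
    hpow (e z) k hk (by rw [← map_pow, h, map_mul]; rfl)
  have h1 : f * n ≠ 1 := fun h => hpow 1 2 le_rfl (by rw [h, one_pow])
  refine ⟨n, hn, fun d hd => ?_⟩
  obtain ⟨z, -, hz⟩ := IsFreeGroup.exists_commute_mem_zpowers h1
  obtain ⟨i, hi⟩ := hz _ (Commute.refl _)
  change z ^ i = f * n at hi
  have hle : Subgroup.zpowers z ≤ Subgroup.zpowers (f * n) := by
    rw [Subgroup.zpowers_le]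
    obtain ⟨k, rfl | rfl⟩ := i.eq_nat_or_neg
    · have hk2 : ¬ 2 ≤ k := fun hk => hpow z k hk (by simpa using hi)
      interval_cases k
      · simp at hi; exact (h1 hi.symm).elim
      · exact ⟨1, by rw [← hi]; simp⟩
    · have hk2 : ¬ 2 ≤ k := fun hk => hpow z⁻¹ k hk (by simpa using hi)
      interval_cases k
      · simp at hi; exact (h1 hi.symm).elim
      · exact ⟨-1, by rw [← hi]; simp⟩
  exact hle (hz d hd)

theorem IsFreeGroup.exists_not_commute_of_normal (hbot : N ≠ ⊥) (hidx : ¬ N.FiniteIndex) :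
    ∃ u ∈ N, ∃ v ∈ N, ¬ Commute u v := by
  obtain ⟨a, b, hab⟩ := IsFreeGroup.nontrivial_generators hbot hidx
  let e := IsFreeGroup.toFreeGroup F
  have hN' : (N.map e.toMonoidHom).Normal := hN.map _ e.surjective
  have hbot' : N.map e.toMonoidHom ≠ ⊥ := fun h =>
    hbot ((Subgroup.map_eq_bot_iff_of_injective N e.injective).1 h)
  obtain ⟨_, ⟨u, hu, rfl⟩, _, ⟨v, hv, rfl⟩, h⟩ := FreeGroup.exists_not_commute_of_normal hab hbot'
  exact ⟨u, hu, v, hv, fun h' => h (h'.map e)⟩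

end InfiniteIndex

/-! ### Conjugacy in fibre squares. -/

/-- The fibre square of a homomorphism. -/
def MonoidHom.fiberSquare {F P : Type*} [Group F] [Group P] (ψ : F →* P) : Subgroup (F × F) :=
  (ψ.comp (MonoidHom.fst F F)).eqLocus (ψ.comp (MonoidHom.snd F F))

theorem MonoidHom.mem_fiberSquare {F P : Type*} [Group F] [Group P] {ψ : F →* P} {g : F × F} :
    g ∈ ψ.fiberSquare ↔ ψ g.1 = ψ g.2 := Iff.rfl

/-- The fibre square of a homomorphism from a finitely generated free group to a residually finite
`p`-group is `p`-conjugacy separable. -/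
theorem IsFreeGroup.isPConjugacySeparable_fiberSquare {p : ℕ} [hp : Fact p.Prime] {F P : Type*}
    [Group F] [IsFreeGroup F] [Group.FG F] [Group P] (hres : Group.ResiduallyFinite P)
    (hP : IsPGroup p P) (ψ : F →* P) : IsPConjugacySeparable p ψ.fiberSquare := by
  classical
  have hF : IsPConjugacySeparable p F := IsFreeGroup.isPConjugacySeparable
  rw [isPConjugacySeparable_iff_exists_isPOpen] at hF ⊢
  rintro ⟨⟨x, y⟩, hxy⟩ ⟨⟨x', y'⟩, hxy'⟩ hnc
  let f₁ : ψ.fiberSquare →* F := (MonoidHom.fst F F).comp ψ.fiberSquare.subtype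
  let f₂ : ψ.fiberSquare →* F := (MonoidHom.snd F F).comp ψ.fiberSquare.subtype
  by_cases h1 : IsConj x x'
  swap
  · obtain ⟨K, hK, h⟩ := hF _ _ h1
    exact ⟨K.comap f₁, hK.comap f₁, fun g hg => h (f₁ g) hg⟩
  by_cases h2 : IsConj y y'
  swap
  · obtain ⟨K, hK, h⟩ := hF _ _ h2
    exact ⟨K.comap f₂, hK.comap f₂, fun g hg => h (f₂ g) hg⟩
  obtain ⟨a, rfl⟩ := isConj_iff.1 h1
  obtain ⟨b, rfl⟩ := isConj_iff.1 h2
  have hbad : ∀ c d, Commute c x → Commute d y → ψ (a * c) ≠ ψ (b * d) := by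
    intro c d hc hd hcd
    refine hnc (isConj_iff.2 ⟨⟨(a * c, b * d), hcd⟩, ?_⟩)
    ext
    · change a * c * x * (a * c)⁻¹ = a * x * a⁻¹
      rw [mul_assoc a, hc.eq]; group
    · change b * d * y * (b * d)⁻¹ = b * y * b⁻¹
      rw [mul_assoc b, hd.eq]; group
  have hx : x ≠ 1 := by
    rintro rfl
    exact hbad (a⁻¹ * b) 1 (Commute.one_right _) (Commute.one_left _) (by simp)
  have hy : y ≠ 1 := by
    rintro rfl
    exact hbad 1 (b⁻¹ * a) (Commute.one_left _) (Commute.one_right _) (by simp)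
  obtain ⟨z, hzx, hz⟩ := IsFreeGroup.exists_commute_mem_zpowers hx
  obtain ⟨w, hwy, hw⟩ := IsFreeGroup.exists_commute_mem_zpowers hy
  have hfz : (Subgroup.zpowers (ψ z) : Set P).Finite :=
    finite_zpowers.2 (hP.isOfFinOrder hp.out.ne_zero _)
  have hfw : (Subgroup.zpowers (ψ w) : Set P).Finite :=
    finite_zpowers.2 (hP.isOfFinOrder hp.out.ne_zero _)
  -- The images of the two cyclic centralizers are finite because `P` is torsion, so one `V`
  -- excludes every failure of `hbad` at once.
  obtain ⟨V, hV, hVT⟩ := IsPOpen.exists_forall_finset (p := p) (hfz.toFinset ×ˢ hfw.toFinset)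
    (fun i V => i.1⁻¹ * ψ (a⁻¹ * b) * i.2 ∉ V) (fun i V W hVW h hmem => h (hVW hmem)) (by
      rintro ⟨s, t⟩ hst
      obtain ⟨⟨i, hi⟩, ⟨j, hj⟩⟩ : s ∈ Subgroup.zpowers (ψ z) ∧ t ∈ Subgroup.zpowers (ψ w) := by
        simpa using hst
      change ψ z ^ i = s at hi
      change ψ w ^ j = t at hj
      have hne : s⁻¹ * ψ (a⁻¹ * b) * t ≠ 1 := by
        intro h
        refine hbad (z ^ i) (w ^ j) (hzx.zpow_left i) (hwy.zpow_left j) ?_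
        rw [map_mul, map_inv, mul_assoc, inv_mul_eq_one, mul_assoc, eq_inv_mul_iff_mul_eq] at h
        rw [map_mul, map_mul, map_zpow, map_zpow, hi, hj, h]
      obtain ⟨V, hV⟩ := Group.exists_finiteIndexNormalSubgroup_notMem _ hne
      exact ⟨V.toSubgroup, ⟨V.isNormal', V.isFiniteIndex', fun g => (hP g).imp fun k hk => by
        rw [hk]; exact V.toSubgroup.one_mem⟩, hV⟩)
  have hL : IsPOpen p (V.comap ψ) := hV.comap ψ
  obtain ⟨K₁, hK₁, -, hC₁⟩ := IsFreeGroup.exists_isPOpen_centralizer hL x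
  obtain ⟨K₂, hK₂, -, hC₂⟩ := IsFreeGroup.exists_isPOpen_centralizer hL y
  refine ⟨K₁.comap f₁ ⊓ K₂.comap f₂, (hK₁.comap f₁).inf (hK₂.comap f₂), ?_⟩
  rintro ⟨⟨c₀, d₀⟩, hcd⟩ ⟨hg₁, hg₂⟩
  replace hg₁ : c₀ * x * c₀⁻¹ * (a * x * a⁻¹)⁻¹ ∈ K₁ := hg₁
  replace hg₂ : d₀ * y * d₀⁻¹ * (b * y * b⁻¹)⁻¹ ∈ K₂ := hg₂
  replace hcd : ψ c₀ = ψ d₀ := hcd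
  obtain ⟨c, hc, hcL⟩ := hC₁ (a⁻¹ * c₀) (by
    convert hK₁.normal.conj_mem _ hg₁ a⁻¹ using 1
    group)
  obtain ⟨d, hd, hdL⟩ := hC₂ (b⁻¹ * d₀) (by
    convert hK₂.normal.conj_mem _ hg₂ b⁻¹ using 1
    group)
  obtain ⟨i, rfl⟩ := hz c hc
  obtain ⟨j, rfl⟩ := hw d hd
  refine hVT (ψ z ^ i, ψ w ^ j) (by simp) ?_
  have h3 := V.mul_mem (V.inv_mem (Subgroup.mem_comap.1 hcL)) (Subgroup.mem_comap.1 hdL)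
  convert h3 using 1
  simp only [map_mul, map_inv, map_zpow, hcd]
  group

/-! ### Kernels of subdirect products. -/

section Kernel

variable {F₁ F₂ : Type u} [Group F₁] [Group F₂] {G : Subgroup (F₁ × F₂)}

theorem IsSubdirectProduct.exists_snd (h : IsSubdirectProduct G) (a : F₁) : ∃ b, (a, b) ∈ G := by
  obtain ⟨⟨a', b⟩, hg, rfl⟩ : a ∈ G.map (MonoidHom.fst F₁ F₂) := h.1 ▸ Subgroup.mem_top a
  exact ⟨b, hg⟩

theorem IsSubdirectProduct.exists_fst (h : IsSubdirectProduct G) (b : F₂) : ∃ a, (a, b) ∈ G := by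
  obtain ⟨⟨a, b'⟩, hg, rfl⟩ : b ∈ G.map (MonoidHom.snd F₁ F₂) := h.2 ▸ Subgroup.mem_top b
  exact ⟨a, hg⟩

/-- The intersection of `G` with the first factor, as a subgroup of that factor. -/
def Subgroup.leftKernel (G : Subgroup (F₁ × F₂)) : Subgroup F₁ := G.comap (MonoidHom.inl F₁ F₂)

/-- The intersection of `G` with the second factor, as a subgroup of that factor. -/
def Subgroup.rightKernel (G : Subgroup (F₁ × F₂)) : Subgroup F₂ := G.comap (MonoidHom.inr F₁ F₂)

theorem Subgroup.mem_leftKernel {a : F₁} : a ∈ G.leftKernel ↔ (a, 1) ∈ G := Iff.rfl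

theorem Subgroup.mem_rightKernel {b : F₂} : b ∈ G.rightKernel ↔ (1, b) ∈ G := Iff.rfl

theorem IsSubdirectProduct.normal_leftKernel (h : IsSubdirectProduct G) :
    G.leftKernel.Normal := ⟨fun n hn a => by
  obtain ⟨b, hb⟩ := h.exists_snd a
  have := G.mul_mem (G.mul_mem hb (Subgroup.mem_leftKernel.1 hn)) (G.inv_mem hb)
  rw [Subgroup.mem_leftKernel]
  simpa using this⟩

theorem IsSubdirectProduct.normal_rightKernel (h : IsSubdirectProduct G) :
    G.rightKernel.Normal := ⟨fun n hn b => by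
  obtain ⟨a, ha⟩ := h.exists_fst b
  have := G.mul_mem (G.mul_mem ha (Subgroup.mem_rightKernel.1 hn)) (G.inv_mem ha)
  rw [Subgroup.mem_rightKernel]
  simpa using this⟩

/-- Every coset of `G` meets `F₁ × {1}`, since an element of `G` can absorb the second coordinate.
-/
theorem IsSubdirectProduct.finiteIndex_of_leftKernel (h : IsSubdirectProduct G)
    (hfin : G.leftKernel.FiniteIndex) : G.FiniteIndex := by
  have : Finite ((F₁ × F₂) ⧸ G) := by
    refine Finite.of_surjective
      (fun q : F₁ ⧸ G.leftKernel => (((Quotient.out q, 1) : F₁ × F₂) : (F₁ × F₂) ⧸ G)) fun q => ?_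
    obtain ⟨⟨a, b⟩, rfl⟩ := QuotientGroup.mk_surjective q
    obtain ⟨a', ha'⟩ := h.exists_fst b
    refine ⟨((a * a'⁻¹ : F₁) : F₁ ⧸ G.leftKernel), ?_⟩
    obtain ⟨n, hn⟩ := QuotientGroup.mk_out_eq_mul G.leftKernel (a * a'⁻¹)
    refine QuotientGroup.eq.2 ?_
    have := G.mul_mem (G.inv_mem (Subgroup.mem_leftKernel.1 n.2)) ha'
    change (Quotient.out ((a * a'⁻¹ : F₁) : F₁ ⧸ G.leftKernel) = _) at hn
    rw [hn]
    convert this using 1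
    ext <;> simp [mul_assoc]
  exact Subgroup.finiteIndex_of_finite_quotient

theorem IsSubdirectProduct.finiteIndex_of_rightKernel (h : IsSubdirectProduct G)
    (hfin : G.rightKernel.FiniteIndex) : G.FiniteIndex := by
  have : Finite ((F₁ × F₂) ⧸ G) := by
    refine Finite.of_surjective
      (fun q : F₂ ⧸ G.rightKernel => (((1, Quotient.out q) : F₁ × F₂) : (F₁ × F₂) ⧸ G)) fun q => ?_
    obtain ⟨⟨a, b⟩, rfl⟩ := QuotientGroup.mk_surjective q
    obtain ⟨b', hb'⟩ := h.exists_snd a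
    refine ⟨((b * b'⁻¹ : F₂) : F₂ ⧸ G.rightKernel), ?_⟩
    obtain ⟨n, hn⟩ := QuotientGroup.mk_out_eq_mul G.rightKernel (b * b'⁻¹)
    refine QuotientGroup.eq.2 ?_
    have := G.mul_mem (G.inv_mem (Subgroup.mem_rightKernel.1 n.2)) hb'
    change (Quotient.out ((b * b'⁻¹ : F₂) : F₂ ⧸ G.rightKernel) = _) at hn
    rw [hn]
    convert this using 1
    ext <;> simp [mul_assoc]
  exact Subgroup.finiteIndex_of_finite_quotient

theorem Subgroup.inf_prod_top_bot_ne_bot :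
    G ⊓ Subgroup.prod (⊤ : Subgroup F₁) (⊥ : Subgroup F₂) ≠ ⊥ ↔ G.leftKernel ≠ ⊥ := by
  refine not_congr ⟨fun h => (Subgroup.eq_bot_iff_forall _).2 fun a ha => ?_,
    fun h => (Subgroup.eq_bot_iff_forall _).2 ?_⟩
  · have := (Subgroup.eq_bot_iff_forall _).1 h (a, 1) ⟨ha, by simp [Subgroup.mem_prod]⟩
    exact (Prod.ext_iff.1 this).1
  · rintro ⟨a, b⟩ ⟨hg, hab⟩
    obtain rfl : b = 1 := by simpa [Subgroup.mem_prod] using hab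
    rw [(Subgroup.eq_bot_iff_forall _).1 h a hg]
    rfl

theorem Subgroup.inf_prod_bot_top_ne_bot :
    G ⊓ Subgroup.prod (⊥ : Subgroup F₁) (⊤ : Subgroup F₂) ≠ ⊥ ↔ G.rightKernel ≠ ⊥ := by
  refine not_congr ⟨fun h => (Subgroup.eq_bot_iff_forall _).2 fun b hb => ?_,
    fun h => (Subgroup.eq_bot_iff_forall _).2 ?_⟩
  · have := (Subgroup.eq_bot_iff_forall _).1 h (1, b) ⟨hb, by simp [Subgroup.mem_prod]⟩
    exact (Prod.ext_iff.1 this).2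
  · rintro ⟨a, b⟩ ⟨hg, hab⟩
    obtain rfl : a = 1 := by simpa [Subgroup.mem_prod] using hab
    rw [(Subgroup.eq_bot_iff_forall _).1 h b hg]
    rfl

end Kernel

/-! ### The quotient of `F₁` by the left kernel. -/

theorem isPGroup_of_mem_zpowers_pow {p : ℕ} {Q : Type*} [Group Q]
    (h : ∀ (q : Q) (l : ℕ), l.Prime → l ≠ p → q ∈ Subgroup.zpowers (q ^ l)) : IsPGroup p Q := by
  intro q
  have key {l : ℕ} (hl : l.Prime) (hlp : l ≠ p) : ∃ i : ℤ, q ^ (l * i : ℤ) = q := by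
    obtain ⟨i, hi⟩ := h q l hl hlp
    exact ⟨i, by rw [zpow_mul, zpow_natCast]; exact hi⟩
  obtain ⟨l, hl, hlp⟩ : ∃ l : ℕ, l.Prime ∧ l ≠ p := by
    by_cases h2 : p = 2
    · exact ⟨3, Nat.prime_three, by omega⟩
    · exact ⟨2, Nat.prime_two, Ne.symm h2⟩
  have hfin : IsOfFinOrder q := by
    obtain ⟨i, hi⟩ := key hl hlp
    -- The exponent `l * i - 1` is nonzero because it is `-1` modulo `l`.
    refine isOfFinOrder_iff_zpow_eq_one.2 ⟨l * i - 1, fun h0 => ?_, by rw [zpow_sub_one, hi, mul_inv_cancel]⟩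
    have : (l : ℤ) ∣ 1 := ⟨i, by omega⟩
    have := Int.natCast_dvd_natCast.1 (by simpa using this : (l : ℤ) ∣ (1 : ℕ))
    exact hl.one_lt.ne' (Nat.dvd_one.1 this)
  have hpos := hfin.orderOf_pos
  have huniq : ∀ {d : ℕ}, d.Prime → d ∣ orderOf q → d = p := by
    intro d hd hdvd
    by_contra hdp
    obtain ⟨i, hi⟩ := key hd hdp
    obtain ⟨m, hm⟩ := hdvd
    have hqm : q ^ m = 1 := by
      rw [← hi, ← zpow_natCast, ← zpow_mul, mul_right_comm, ← Nat.cast_mul, ← hm, zpow_mul,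
        zpow_natCast, pow_orderOf_eq_one, one_zpow]
    have h1 := Nat.le_of_dvd (Nat.pos_of_ne_zero (by
      rintro rfl
      rw [mul_zero] at hm
      omega))
      (orderOf_dvd_of_pow_eq_one hqm)
    have h2 := hd.two_le
    nlinarith
  exact ⟨_, by rw [← Nat.eq_prime_pow_of_unique_prime_dvd hpos.ne' huniq, pow_orderOf_eq_one]⟩

theorem IsFreeGroup.isFinitelyPresented {F : Type*} [Group F] [IsFreeGroup F] [Group.FG F] :
    Group.IsFinitelyPresented F := by
  have := IsFreeGroup.finite_generators (F := F)
  exact Group.IsFinitelyPresented.equiv (IsFreeGroup.toFreeGroup F).symm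

/-- The kernel of a homomorphism from a finitely generated group onto a free group is finitely
generated as a normal subgroup. -/
theorem IsFreeGroup.isFinitelyNormallyGenerated_ker {G F : Type*} [Group G] [Group F]
    [IsFreeGroup F] [Group.FG G] (f : G →* F) (hf : Function.Surjective f) :
    f.ker.IsFinitelyNormallyGenerated := by
  let σ : F →* G := IsFreeGroup.lift fun a => (hf (IsFreeGroup.of a)).choose
  have hσ : f.comp σ = MonoidHom.id F := by
    refine IsFreeGroup.ext_hom fun a => ?_
    simp only [MonoidHom.comp_apply, σ, IsFreeGroup.lift_of, MonoidHom.id_apply]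
    exact (hf (IsFreeGroup.of a)).choose_spec
  have hσ' (y : F) : f (σ y) = y := DFunLike.congr_fun hσ y
  obtain ⟨S, hS, hSfin⟩ := Group.fg_iff.1 (inferInstance : Group.FG G)
  let r : G → G := fun g => g * (σ (f g))⁻¹
  refine ⟨r '' S, hSfin.image r, le_antisymm ?_ fun g hg => ?_⟩
  · refine Subgroup.normalClosure_le_normal ?_
    rintro _ ⟨s, -, rfl⟩
    simp [r, MonoidHom.mem_ker, hσ']
  · set R := Subgroup.normalClosure (r '' S)
    have heq : QuotientGroup.mk' R = (QuotientGroup.mk' R).comp (σ.comp f) := by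
      refine MonoidHom.eq_of_eqOn_dense hS fun s hs => ?_
      have : r s ∈ R := Subgroup.subset_normalClosure ⟨s, hs, rfl⟩
      rw [← QuotientGroup.eq_one_iff, QuotientGroup.mk_mul, QuotientGroup.mk_inv,
        mul_inv_eq_one] at this
      exact this
    have := DFunLike.congr_fun heq g
    rw [MonoidHom.comp_apply, MonoidHom.comp_apply, MonoidHom.mem_ker.1 hg, map_one, map_one] at this
    exact (QuotientGroup.eq_one_iff g).1 this

section Quotient

variable {F₁ F₂ : Type u} [Group F₁] [Group F₂] {G : Subgroup (F₁ × F₂)}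

theorem IsSubdirectProduct.fst_surjective (h : IsSubdirectProduct G) :
    Function.Surjective ((MonoidHom.fst F₁ F₂).comp G.subtype) := fun a => by
  obtain ⟨b, hb⟩ := h.exists_snd a
  exact ⟨⟨(a, b), hb⟩, rfl⟩

theorem IsSubdirectProduct.snd_surjective (h : IsSubdirectProduct G) :
    Function.Surjective ((MonoidHom.snd F₁ F₂).comp G.subtype) := fun b => by
  obtain ⟨a, ha⟩ := h.exists_fst b
  exact ⟨⟨(a, b), ha⟩, rfl⟩

variable [IsFreeGroup F₁] [IsFreeGroup F₂]

/-- The left kernel is the image in `F₁` of the kernel of `G → F₂`, which is finitely normally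
generated because `F₂` is free. -/
theorem IsSubdirectProduct.isFinitelyPresented_quotient (h : IsSubdirectProduct G)
    (hG : Group.FG G) [G.leftKernel.Normal] :
    Group.IsFinitelyPresented (F₁ ⧸ G.leftKernel) := by
  have : Group.FG F₁ := Group.fg_of_surjective h.fst_surjective
  have : Group.IsFinitelyPresented F₁ := IsFreeGroup.isFinitelyPresented
  refine Group.IsFinitelyPresented.quotient _ ?_
  have h1 := (IsFreeGroup.isFinitelyNormallyGenerated_ker _ h.snd_surjective).map h.fst_surjective
  convert h1
  ext a
  constructor
  · intro ha
    exact ⟨⟨(a, 1), ha⟩, rfl, rfl⟩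
  · rintro ⟨⟨⟨a', b⟩, hg⟩, hb, rfl⟩
    obtain rfl : b = 1 := hb
    exact hg

/-- With `x`, `y` in the kernels generating their centralizers, a conjugator in `G` from `(x, y)` to
`(gxg⁻¹, y)` has its second coordinate in the right kernel, hence its first in the left kernel,
which forces `g` into the left kernel. -/
theorem IsSubdirectProduct.residuallyFinite_quotient {p : ℕ} (h : IsSubdirectProduct G)
    (hG : IsPConjugacySeparable p G) (hl : G.leftKernel ≠ ⊥) (hr : G.rightKernel ≠ ⊥)
    (hidx : ¬ G.FiniteIndex) [hN₁ : G.leftKernel.Normal] :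
    Group.ResiduallyFinite (F₁ ⧸ G.leftKernel) := by
  rw [isPConjugacySeparable_iff_exists_isPOpen] at hG
  have hN₂ := h.normal_rightKernel
  obtain ⟨x, hx, hCx⟩ := IsFreeGroup.exists_mem_commute_mem_zpowers hl
    (mt h.finiteIndex_of_leftKernel hidx) 1
  obtain ⟨y, hy, hCy⟩ := IsFreeGroup.exists_mem_commute_mem_zpowers hr
    (mt h.finiteIndex_of_rightKernel hidx) 1
  simp only [one_mul] at hCx hCy
  rw [Group.residuallyFinite_iff_exists_finiteIndex]
  intro q hq
  obtain ⟨g, rfl⟩ := QuotientGroup.mk_surjective q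
  replace hq : g ∉ G.leftKernel := fun h => hq ((QuotientGroup.eq_one_iff g).2 h)
  have hmem {a b} (ha : a ∈ G.leftKernel) (hb : b ∈ G.rightKernel) : (a, b) ∈ G := by
    simpa using G.mul_mem (Subgroup.mem_leftKernel.1 ha) (Subgroup.mem_rightKernel.1 hb)
  obtain ⟨K, hK, hKg⟩ := hG ⟨(x, y), hmem hx hy⟩ ⟨(g * x * g⁻¹, y), hmem (hN₁.conj_mem x hx g) hy⟩ (by
    intro hc
    obtain ⟨⟨⟨c, d⟩, hcd⟩, hc⟩ := isConj_iff.1 hc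
    have hc' := congrArg Subtype.val hc
    obtain ⟨hc1, hc2⟩ : c * x * c⁻¹ = g * x * g⁻¹ ∧ d * y * d⁻¹ = y := Prod.ext_iff.1 hc'
    have hd : d ∈ G.rightKernel := (Subgroup.zpowers_le.2 hy) (hCy d (mul_inv_eq_iff_eq_mul.1 hc2))
    have hcN : c ∈ G.leftKernel := by
      rw [Subgroup.mem_leftKernel]
      simpa using G.mul_mem hcd (G.inv_mem (Subgroup.mem_rightKernel.1 hd))
    have hgc : g⁻¹ * c ∈ G.leftKernel := by
      refine (Subgroup.zpowers_le.2 hx) (hCx _ ?_)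
      rw [commute_iff_eq, ← mul_inv_eq_iff_eq_mul, mul_inv_rev, inv_inv]
      calc g⁻¹ * c * x * (c⁻¹ * g) = g⁻¹ * (c * x * c⁻¹) * g := by group
        _ = x := by rw [hc1]; group
    refine hq ?_
    have := G.leftKernel.mul_mem hcN (G.leftKernel.inv_mem hgc)
    simpa using this)
  have := hK.finiteIndex
  let f₁ := (MonoidHom.fst F₁ F₂).comp G.subtype
  -- If `g` lay in `V`, write `g = M * k` in `F₁` with `M` in the left kernel and `k` from `K`.
  -- Conjugation by `M` would then match the test pair modulo `K`, the error being a conjugate of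
  -- the commutator of `(x, 1)` with `k`.
  let V := K.map f₁ ⊔ G.leftKernel
  have hKV : (K.map f₁).FiniteIndex :=
    ⟨fun h0 => hK.finiteIndex.index_ne_zero
      (Nat.eq_zero_of_zero_dvd (h0 ▸ K.index_map_dvd h.fst_surjective))⟩
  have hV : V.FiniteIndex := Subgroup.finiteIndex_of_le le_sup_left
  refine ⟨V.map (QuotientGroup.mk' G.leftKernel), ⟨fun h0 => hV.index_ne_zero
    (Nat.eq_zero_of_zero_dvd (h0 ▸ V.index_map_dvd (QuotientGroup.mk'_surjective _)))⟩, ?_⟩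
  rintro ⟨v, hv, hvg⟩
  have hgV : g ∈ V := by
    have h1 : v⁻¹ * g ∈ V := Subgroup.mem_sup_right (QuotientGroup.eq.1 hvg)
    simpa using V.mul_mem hv h1
  obtain ⟨_, ⟨k, hk, rfl⟩, m, hm, rfl⟩ := Subgroup.mem_sup_of_normal_right.1 hgV
  have hm' : f₁ k * m * (f₁ k)⁻¹ ∈ G.leftKernel := hN₁.conj_mem m hm _
  let M : G := ⟨(f₁ k * m * (f₁ k)⁻¹, 1), hm'⟩
  let Z : G := ⟨(x, 1), hx⟩
  refine hKg M ?_
  convert hK.normal.conj_mem _ (K.mul_mem (hK.normal.conj_mem k hk Z) (K.inv_mem hk)) M using 1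
  ext
  · simp [M, Z, f₁, mul_assoc]
  · simp [M, Z]

/-- For a prime `l ≠ p`, the test pair uses self-centralizing representatives of `h₁ ^ l` and `h₂ ^
l`: a conjugator in `G` would exhibit the class of `h₁` as a power of its `l`-th power. Finite
`p`-groups cannot separate the pair otherwise, since taking `l`-th powers is invertible there. -/
theorem IsSubdirectProduct.isPGroup_quotient {p : ℕ} (hp : p.Prime) (h : IsSubdirectProduct G)
    (hG : IsPConjugacySeparable p G) (hl : G.leftKernel ≠ ⊥) (hr : G.rightKernel ≠ ⊥)
    (hidx : ¬ G.FiniteIndex) [hN₁ : G.leftKernel.Normal] : IsPGroup p (F₁ ⧸ G.leftKernel) := by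
  rw [isPConjugacySeparable_iff_exists_isPOpen] at hG
  have hN₂ := h.normal_rightKernel
  refine isPGroup_of_mem_zpowers_pow fun q l hlp hlne => ?_
  obtain ⟨h₁, rfl⟩ := QuotientGroup.mk_surjective q
  by_contra hq
  obtain ⟨h₂, hh⟩ := h.exists_snd h₁
  obtain ⟨n₁, hn₁, hCx⟩ := IsFreeGroup.exists_mem_commute_mem_zpowers hl
    (mt h.finiteIndex_of_leftKernel hidx) (h₁ ^ l)
  obtain ⟨n₂, hn₂, hCy⟩ := IsFreeGroup.exists_mem_commute_mem_zpowers hr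
    (mt h.finiteIndex_of_rightKernel hidx) (h₂ ^ l)
  set x := h₁ ^ l * n₁ with hx
  set y := h₂ ^ l * n₂ with hy
  have hmkx : (x : F₁ ⧸ G.leftKernel) = (h₁ : F₁ ⧸ G.leftKernel) ^ l := by
    rw [hx, QuotientGroup.mk_mul, (QuotientGroup.eq_one_iff n₁).2 hn₁, mul_one, QuotientGroup.mk_pow]
  have hmem {n} (hn : n ∈ G.leftKernel) : (h₁ ^ l * n, y) ∈ G := by
    simpa using G.mul_mem (G.mul_mem (G.pow_mem hh l) (Subgroup.mem_leftKernel.1 hn))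
      (Subgroup.mem_rightKernel.1 hn₂)
  have hconj : h₁ * x * h₁⁻¹ = h₁ ^ l * (h₁ * n₁ * h₁⁻¹) := by rw [hx]; group
  obtain ⟨K, hK, hKg⟩ := hG ⟨(x, y), hmem hn₁⟩
    ⟨(h₁ * x * h₁⁻¹, y), hconj ▸ hmem (hN₁.conj_mem n₁ hn₁ h₁)⟩ (by
    intro hc
    obtain ⟨⟨⟨c, d⟩, hcd⟩, hc⟩ := isConj_iff.1 hc
    have hc' := congrArg Subtype.val hc
    obtain ⟨hc1, hc2⟩ : c * x * c⁻¹ = h₁ * x * h₁⁻¹ ∧ d * y * d⁻¹ = y := Prod.ext_iff.1 hc'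
    obtain ⟨j, hj⟩ := hCy d (mul_inv_eq_iff_eq_mul.1 hc2)
    obtain ⟨i, hi⟩ := hCx (h₁⁻¹ * c) (by
      rw [commute_iff_eq, ← mul_inv_eq_iff_eq_mul, mul_inv_rev, inv_inv]
      calc h₁⁻¹ * c * x * (c⁻¹ * h₁) = h₁⁻¹ * (c * x * c⁻¹) * h₁ := by group
        _ = x := by rw [hc1]; group)
    change y ^ j = d at hj
    change x ^ i = h₁⁻¹ * c at hi
    have h1 : c * (x ^ j)⁻¹ ∈ G.leftKernel := by
      rw [Subgroup.mem_leftKernel]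
      have := G.mul_mem hcd (G.inv_mem (G.zpow_mem (hmem hn₁) j))
      simpa [← hj] using this
    rw [← QuotientGroup.eq_one_iff, QuotientGroup.mk_mul, QuotientGroup.mk_inv, mul_inv_eq_one,
      eq_mul_of_inv_mul_eq hi.symm, QuotientGroup.mk_mul, QuotientGroup.mk_zpow,
      QuotientGroup.mk_zpow, hmkx] at h1
    refine hq ⟨j - i, ?_⟩
    change ((h₁ : F₁ ⧸ G.leftKernel) ^ l) ^ (j - i) = _
    rw [zpow_sub, ← h1, mul_inv_cancel_right])
  let H : G := ⟨(h₁, h₂), hh⟩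
  obtain ⟨s, hs⟩ := hK.exists_pow_mem H
  -- Bézout for `p ^ s` and `l` writes `h₁ = m * k₁ * x ^ b`, with `m` in the left kernel and `k₁`
  -- from `K`; the factor `x ^ b` is harmless when conjugating `x`.
  obtain ⟨a, b, hab⟩ : IsCoprime ((p ^ s : ℕ) : ℤ) (l : ℤ) :=
    Nat.isCoprime_iff_coprime.2 (((Nat.coprime_primes hp hlp).2 hlne.symm).pow_left s)
  let k : G := (H ^ p ^ s) ^ a
  have hk : k ∈ K := K.zpow_mem hs a
  let k₁ : F₁ := (h₁ ^ p ^ s) ^ a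
  let m : F₁ := h₁ * (x ^ b)⁻¹ * k₁⁻¹
  have hm : m ∈ G.leftKernel := by
    rw [← QuotientGroup.eq_one_iff, QuotientGroup.mk_mul, QuotientGroup.mk_mul, QuotientGroup.mk_inv,
      QuotientGroup.mk_inv, QuotientGroup.mk_zpow, QuotientGroup.mk_zpow, hmkx, QuotientGroup.mk_pow,
      ← zpow_natCast, ← zpow_natCast, ← zpow_mul, ← zpow_mul, ← zpow_neg, ← zpow_neg, ← zpow_one_add,
      ← zpow_add]
    rw [show (1 + -((l : ℤ) * b) + -(((p ^ s : ℕ) : ℤ) * a)) = 0 by linarith, zpow_zero]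
  let M : G := ⟨(m, 1), hm⟩
  let Z : G := ⟨(n₁, 1), hn₁⟩
  refine hKg M ?_
  have hmem' := hK.normal.conj_mem _
    (K.mul_mem (hK.normal.conj_mem k hk Z) (K.inv_mem hk)) (M * H ^ l)
  convert hmem' using 1
  -- Hence the commutator of `x = h₁ ^ l * n₁` with `k₁` is a conjugate of that of `n₁`, and `(n₁,
  -- 1)` does lie in `G`.
  have hcomm : Commute k₁ (h₁ ^ l) := ((Commute.refl h₁).pow_left _).zpow_left a |>.pow_right l
  have hh₁ : h₁ = m * k₁ * x ^ b := by simp only [m]; group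
  have hY : h₁ * x * h₁⁻¹ = m * k₁ * x * k₁⁻¹ * m⁻¹ := by
    rw [hh₁]; group
  ext
  · change m * x * m⁻¹ * (h₁ * x * h₁⁻¹)⁻¹ =
      m * h₁ ^ l * (n₁ * k₁ * n₁⁻¹ * k₁⁻¹) * (m * h₁ ^ l)⁻¹
    have h1 : k₁⁻¹ * (h₁ ^ l)⁻¹ = (h₁ ^ l)⁻¹ * k₁⁻¹ := hcomm.inv_inv.eq
    rw [hY]
    calc m * x * m⁻¹ * (m * k₁ * x * k₁⁻¹ * m⁻¹)⁻¹
        = m * x * k₁ * x⁻¹ * k₁⁻¹ * m⁻¹ := by group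
      _ = m * h₁ ^ l * n₁ * k₁ * n₁⁻¹ * ((h₁ ^ l)⁻¹ * k₁⁻¹) * m⁻¹ := by
        rw [hx, mul_inv_rev]; simp only [mul_assoc]
      _ = _ := by rw [← h1, mul_inv_rev m (h₁ ^ l)]; simp only [mul_assoc]
  · simp [M, Z, H]

end Quotient

/-! ### Embedding into rank two. -/

/-- The free group of countable rank embeds into the free group of rank two. -/
theorem FreeGroup.exists_injective_int :
    ∃ f : FreeGroup ℤ →* FreeGroup (Fin 2), Function.Injective f := by
  let shift : Multiplicative ℤ →* MulAut (FreeGroup ℤ) :=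
    { toFun := fun k => FreeGroup.freeGroupCongr (Equiv.addLeft k.toAdd)
      map_one' := by
        ext x
        simp
      map_mul' := fun k l => by
        have : (FreeGroup.freeGroupCongr (Equiv.addLeft (k * l).toAdd)).toMonoidHom =
            ((FreeGroup.freeGroupCongr (Equiv.addLeft k.toAdd)) *
              (FreeGroup.freeGroupCongr (Equiv.addLeft l.toAdd)) : MulAut (FreeGroup ℤ)).toMonoidHom := by
          ext x
          simp [add_assoc]
        ext x
        exact DFunLike.congr_fun this x }
  have hshift (k : Multiplicative ℤ) (x : ℤ) : shift k (FreeGroup.of x) = FreeGroup.of (k.toAdd + x) := by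
    simp [shift]
  -- In the extension by the shift, conjugating the zeroth generator by `t ^ i` gives the `i`-th. So
  -- `π` after `f` is the inclusion, and `f` is injective.
  let t : FreeGroup ℤ ⋊[shift] Multiplicative ℤ := SemidirectProduct.inr (Multiplicative.ofAdd 1)
  let b : FreeGroup ℤ ⋊[shift] Multiplicative ℤ := SemidirectProduct.inl (FreeGroup.of 0)
  let π : FreeGroup (Fin 2) →* FreeGroup ℤ ⋊[shift] Multiplicative ℤ := FreeGroup.lift ![t, b]
  let f : FreeGroup ℤ →* FreeGroup (Fin 2) :=
    FreeGroup.lift fun i => FreeGroup.of 0 ^ i * FreeGroup.of 1 * (FreeGroup.of 0 ^ i)⁻¹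
  have hπf : π.comp f = SemidirectProduct.inl := by
    ext1 i
    have ht : t ^ i = SemidirectProduct.inr (Multiplicative.ofAdd i) := by
      simp only [t, ← _root_.map_zpow, ← ofAdd_zsmul, smul_eq_mul, mul_one]
    have h1 := SemidirectProduct.inl_aut (φ := shift) (Multiplicative.ofAdd i) (FreeGroup.of (0 : ℤ))
    rw [hshift, toAdd_ofAdd, add_zero] at h1
    rw [h1]
    simp only [MonoidHom.comp_apply, f, FreeGroup.lift_apply_of, _root_.map_mul, _root_.map_inv,
      _root_.map_zpow, π, Matrix.cons_val_zero, Matrix.cons_val_one, ht, b]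
  refine ⟨f, fun x y hxy => SemidirectProduct.inl_injective (φ := shift) ?_⟩
  rw [← hπf, MonoidHom.comp_apply, MonoidHom.comp_apply, hxy]

theorem IsFreeGroup.exists_injective_freeGroup_fin_two (F : Type*) [Group F] [IsFreeGroup F]
    [Group.FG F] : ∃ f : F →* FreeGroup (Fin 2), Function.Injective f := by
  have := IsFreeGroup.finite_generators (F := F)
  obtain ⟨g, hg⟩ := Countable.exists_injective_nat (IsFreeGroup.Generators F)
  obtain ⟨f, hf⟩ := FreeGroup.exists_injective_int
  refine ⟨f.comp ((FreeGroup.map fun x => (g x : ℤ)).comp (IsFreeGroup.toFreeGroup F).toMonoidHom), ?_⟩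
  exact hf.comp ((FreeGroup.map_injective (Nat.cast_injective.comp hg)).comp
    (IsFreeGroup.toFreeGroup F).injective)

/-! ### Rigidity of decompositions into two free factors. -/

/-- In a product of two free groups, a multiplicatively closed set that commutes with a noncommuting
pair lies in one of the factors. -/
theorem IsFreeGroup.snd_eq_one_or_fst_eq_one {A B : Type*} [Group A] [Group B] [IsFreeGroup A]
    [IsFreeGroup B] {M₁ M₂ : Set (A × B)} (hcomm : ∀ m ∈ M₁, ∀ n ∈ M₂, Commute m n)
    (hmul : ∀ m ∈ M₁, ∀ m' ∈ M₁, m * m' ∈ M₁)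
    (hM₂ : ∃ u ∈ M₂, ∃ v ∈ M₂, ¬ Commute u v) :
    (∀ m ∈ M₁, m.2 = 1) ∨ (∀ m ∈ M₁, m.1 = 1) := by
  obtain ⟨u, hu, v, hv, huv⟩ := hM₂
  have key : ∀ m ∈ M₁, m.1 = 1 ∨ m.2 = 1 := by
    rintro ⟨a, b⟩ hm
    by_contra! h
    have h1 := hcomm _ hm _ hu
    have h2 := hcomm _ hm _ hv
    refine huv (Prod.ext ?_ ?_)
    · exact IsFreeGroup.commute_of_commute h.1 (congrArg Prod.fst h1.eq).symm
        (congrArg Prod.fst h2.eq).symm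
    · exact IsFreeGroup.commute_of_commute h.2 (congrArg Prod.snd h1.eq).symm
        (congrArg Prod.snd h2.eq).symm
  by_contra! h
  obtain ⟨⟨m, hm, hm2⟩, ⟨n, hn, hn1⟩⟩ := h
  have hm1 := (key m hm).resolve_right hm2
  have hn2 := (key n hn).resolve_left hn1
  rcases key _ (hmul m hm n hn) with h | h
  · exact hn1 (by simpa [hm1] using h)
  · exact hm2 (by simpa [hn2] using h)

section ProductDecomposition

variable {F₁ F₂ A B : Type*} [Group F₁] [Group F₂] [Group A] [Group B] [IsFreeGroup F₁]
  [IsFreeGroup F₂] {S : Subgroup (F₁ × F₂)}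

/-- The `B`-part of an element commutes with the nonabelian group `S ∩ F₁`, so its first coordinate
is trivial by transitivity of commutation; symmetrically for the `A`-part. The `A`-part is therefore
`(g.1, 1)`. -/
theorem IsFreeGroup.fst_mem_of_factors_le (e : S ≃* A × B)
    (h₁ : ∃ u v, (u, 1) ∈ S ∧ (v, 1) ∈ S ∧ ¬ Commute u v)
    (h₂ : ∃ u v, (1, u) ∈ S ∧ (1, v) ∈ S ∧ ¬ Commute u v)
    (he₁ : ∀ k : S, k.1.2 = 1 → (e k).2 = 1) (he₂ : ∀ k : S, k.1.1 = 1 → (e k).1 = 1)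
    {g : F₁ × F₂} (hg : g ∈ S) : (g.1, 1) ∈ S := by
  have comm₁ (n k : S) (hn : (e n).1 = 1) (hk : k.1.2 = 1) : Commute n.1.1 k.1.1 := by
    have : Commute n k := e.injective (by
      rw [map_mul, map_mul]
      exact Prod.ext (by simp [hn]) (by simp [he₁ k hk]))
    exact congrArg (fun x : S => x.1.1) this.eq
  have comm₂ (n k : S) (hn : (e n).2 = 1) (hk : k.1.1 = 1) : Commute n.1.2 k.1.2 := by
    have : Commute n k := e.injective (by
      rw [map_mul, map_mul]
      exact Prod.ext (by simp [he₂ k hk]) (by simp [hn]))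
    exact congrArg (fun x : S => x.1.2) this.eq
  set k : S := ⟨g, hg⟩
  set m : S := e.symm ((e k).1, 1)
  set n : S := e.symm (1, (e k).2)
  have hmn : m * n = k := by
    apply e.injective
    simp [m, n]
  have hn : n.1.1 = 1 := by
    by_contra hne
    obtain ⟨u, v, hu, hv, huv⟩ := h₁
    exact huv (IsFreeGroup.commute_of_commute hne (comm₁ n ⟨_, hu⟩ (by simp [n]) rfl).symm
      (comm₁ n ⟨_, hv⟩ (by simp [n]) rfl).symm)
  have hm : m.1.2 = 1 := by
    by_contra hne
    obtain ⟨u, v, hu, hv, huv⟩ := h₂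
    exact huv (IsFreeGroup.commute_of_commute hne (comm₂ m ⟨_, hu⟩ (by simp [m]) rfl).symm
      (comm₂ m ⟨_, hv⟩ (by simp [m]) rfl).symm)
  have hmg : m.1.1 = g.1 := by
    have := congrArg (fun x : S => x.1.1) hmn
    simpa [hn, k] using this
  have := m.2
  rwa [← Prod.mk.eta (p := m.1), hmg, hm] at this

/-- If a subgroup of a product of free groups that meets both factors in nonabelian subgroups is
itself a product of two free groups, then it is the product of its projections. -/
theorem IsFreeGroup.fst_mem_of_mulEquiv_prod [IsFreeGroup A] [IsFreeGroup B] (e : S ≃* A × B)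
    (h₁ : ∃ u v, (u, 1) ∈ S ∧ (v, 1) ∈ S ∧ ¬ Commute u v)
    (h₂ : ∃ u v, (1, u) ∈ S ∧ (1, v) ∈ S ∧ ¬ Commute u v)
    {g : F₁ × F₂} (hg : g ∈ S) : (g.1, 1) ∈ S := by
  set M₁ : Set (A × B) := e '' {k | k.1.2 = 1}
  set M₂ : Set (A × B) := e '' {k | k.1.1 = 1}
  have hcomm : ∀ m ∈ M₁, ∀ n ∈ M₂, Commute m n := by
    rintro _ ⟨m, hm, rfl⟩ _ ⟨n, hn, rfl⟩
    have : Commute m n := by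
      refine Subtype.ext (Prod.ext ?_ ?_)
      · have hn : n.1.1 = 1 := hn
        simp [hn]
      · have hm : m.1.2 = 1 := hm
        simp [hm]
    exact this.map e
  have hmul₁ : ∀ m ∈ M₁, ∀ m' ∈ M₁, m * m' ∈ M₁ := by
    rintro _ ⟨m, hm, rfl⟩ _ ⟨n, hn, rfl⟩
    refine ⟨m * n, ?_, map_mul e m n⟩
    have hm : m.1.2 = 1 := hm
    have hn : n.1.2 = 1 := hn
    simp [hm, hn]
  have hmul₂ : ∀ m ∈ M₂, ∀ m' ∈ M₂, m * m' ∈ M₂ := by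
    rintro _ ⟨m, hm, rfl⟩ _ ⟨n, hn, rfl⟩
    refine ⟨m * n, ?_, map_mul e m n⟩
    have hm : m.1.1 = 1 := hm
    have hn : n.1.1 = 1 := hn
    simp [hm, hn]
  have hM₁ : ∃ u ∈ M₁, ∃ v ∈ M₁, ¬ Commute u v := by
    obtain ⟨u, v, hu, hv, huv⟩ := h₁
    refine ⟨_, ⟨⟨_, hu⟩, rfl, rfl⟩, _, ⟨⟨_, hv⟩, rfl, rfl⟩, fun h => huv ?_⟩
    exact congrArg (fun x : S => x.1.1) (Commute.of_map e.injective h).eq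
  have hM₂ : ∃ u ∈ M₂, ∃ v ∈ M₂, ¬ Commute u v := by
    obtain ⟨u, v, hu, hv, huv⟩ := h₂
    refine ⟨_, ⟨⟨_, hu⟩, rfl, rfl⟩, _, ⟨⟨_, hv⟩, rfl, rfl⟩, fun h => huv ?_⟩
    exact congrArg (fun x : S => x.1.2) (Commute.of_map e.injective h).eq
  have hne : ∃ w ∈ M₂, w ≠ 1 := by
    obtain ⟨u, hu, v, -, huv⟩ := hM₂
    exact ⟨u, hu, fun h => huv (h ▸ Commute.one_left v)⟩
  obtain ⟨u, hu, v, hv, huv⟩ := id hM₁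
  obtain ⟨w, hw, hw1⟩ := hne
  -- If both images lay in the same factor, `M₁` would commute there with the nontrivial `w` and be
  -- abelian. The two remaining cases differ by swapping `A` and `B`.
  rcases IsFreeGroup.snd_eq_one_or_fst_eq_one hcomm hmul₁ hM₂ with h | h <;>
    rcases IsFreeGroup.snd_eq_one_or_fst_eq_one (fun m hm n hn => (hcomm n hn m hm).symm) hmul₂ hM₁
      with h' | h'
  · refine (huv (Prod.ext ?_ (by simp [h u hu, h v hv]))).elim
    exact IsFreeGroup.commute_of_commute (fun hw' => hw1 (Prod.ext hw' (h' w hw)))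
      (congrArg Prod.fst (hcomm u hu w hw).eq) (congrArg Prod.fst (hcomm v hv w hw).eq)
  · exact IsFreeGroup.fst_mem_of_factors_le e h₁ h₂ (fun k hk => h _ ⟨k, hk, rfl⟩)
      (fun k hk => h' _ ⟨k, hk, rfl⟩) hg
  · exact IsFreeGroup.fst_mem_of_factors_le (e.trans MulEquiv.prodComm) h₁ h₂
      (fun k hk => h _ ⟨k, hk, rfl⟩) (fun k hk => h' _ ⟨k, hk, rfl⟩) hg
  · refine (huv (Prod.ext (by simp [h u hu, h v hv]) ?_)).elim
    exact IsFreeGroup.commute_of_commute (fun hw' => hw1 (Prod.ext (h' w hw) hw'))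
      (congrArg Prod.snd (hcomm u hu w hw).eq) (congrArg Prod.snd (hcomm v hv w hw).eq)

end ProductDecomposition

/-- Roots are unique, so conjugation fixing `x ^ n` fixes `x`. Noncommuting pairs thus survive
passage to powers, hence to finite-index subgroups. -/
theorem IsMulTorsionFree.commute_of_pow {F : Type*} [Group F] [IsMulTorsionFree F] {x y : F} {n : ℕ}
    (hn : n ≠ 0) (h : Commute (x ^ n) y) : Commute x y := by
  have : y * x * y⁻¹ = x := pow_left_injective hn (by
    simp only [conj_pow]
    rw [← h.eq, mul_inv_cancel_right])
  exact (mul_inv_eq_iff_eq_mul.1 this).symm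

/-- A full subdirect product of infinite index of two free groups is not
virtually a product of two free groups. -/
theorem IsSubdirectProduct.isEmpty_mulEquiv_prod {F₁ F₂ : Type u} [Group F₁] [Group F₂]
    [IsFreeGroup F₁] [IsFreeGroup F₂] {G : Subgroup (F₁ × F₂)} (h : IsSubdirectProduct G)
    (hl : G.leftKernel ≠ ⊥) (hr : G.rightKernel ≠ ⊥) (hidx : ¬ G.FiniteIndex) (K : Subgroup G)
    [hK : K.FiniteIndex] {A B : Type*} [Group A] [Group B] [IsFreeGroup A] [IsFreeGroup B] :
    IsEmpty (K ≃* A × B) := by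
  refine ⟨fun e => ?_⟩
  have := h.normal_leftKernel
  have := h.normal_rightKernel
  have hl' : ¬ G.leftKernel.FiniteIndex := fun hf => hidx (h.finiteIndex_of_leftKernel hf)
  have hr' : ¬ G.rightKernel.FiniteIndex := fun hf => hidx (h.finiteIndex_of_rightKernel hf)
  have hpow : ∃ n ≠ 0, ∀ g ∈ G, g ^ n ∈ K.map G.subtype := by
    have := Subgroup.finiteIndex_normalCore K
    refine ⟨K.normalCore.index, Subgroup.FiniteIndex.index_ne_zero, fun g hg =>
      ⟨⟨g, hg⟩ ^ K.normalCore.index, K.normalCore_le (K.normalCore.pow_index_mem _), rfl⟩⟩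
  obtain ⟨n, hn, hpow⟩ := hpow
  have noncomm {F : Type u} [Group F] [IsFreeGroup F] {u v : F} (huv : ¬ Commute u v) :
      ¬ Commute (u ^ n) (v ^ n) := fun hc => huv
    (IsMulTorsionFree.commute_of_pow hn
      (IsMulTorsionFree.commute_of_pow hn hc.symm).symm)
  set S := K.map G.subtype
  have h₁ : ∃ u v, (u, 1) ∈ S ∧ (v, 1) ∈ S ∧ ¬ Commute u v := by
    obtain ⟨u, hu, v, hv, huv⟩ := IsFreeGroup.exists_not_commute_of_normal hl hl'
    exact ⟨u ^ n, v ^ n, by simpa using hpow _ hu, by simpa using hpow _ hv, noncomm huv⟩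
  have h₂ : ∃ u v, (1, u) ∈ S ∧ (1, v) ∈ S ∧ ¬ Commute u v := by
    obtain ⟨u, hu, v, hv, huv⟩ := IsFreeGroup.exists_not_commute_of_normal hr hr'
    exact ⟨u ^ n, v ^ n, by simpa using hpow _ hu, by simpa using hpow _ hv, noncomm huv⟩
  have hS := fun {g} => IsFreeGroup.fst_mem_of_mulEquiv_prod (g := g)
    ((K.equivMapOfInjective _ G.subtype_injective).symm.trans e) h₁ h₂
  have hfin : (K.map ((MonoidHom.fst F₁ F₂).comp G.subtype)).FiniteIndex :=
    ⟨fun h0 => hK.index_ne_zero <| Nat.eq_zero_of_zero_dvd <|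
      h0 ▸ K.index_map_dvd h.fst_surjective⟩
  refine hl' (Subgroup.finiteIndex_of_le (H := K.map ((MonoidHom.fst F₁ F₂).comp G.subtype)) ?_)
  rintro _ ⟨k, hk, rfl⟩
  have := hS (g := k) ⟨k, hk, rfl⟩
  obtain ⟨k', -, hk'⟩ := this
  rw [Subgroup.mem_leftKernel]
  exact (show G.subtype k' = (k.1.1, 1) from hk') ▸ k'.2

/-! ### Finite generation and infinite index of fibre squares. -/

theorem Subgroup.finiteIndex_comap {G H : Type*} [Group G] [Group H] (f : G →* H) (K : Subgroup H)
    [K.FiniteIndex] : (K.comap f).FiniteIndex :=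
  ⟨by rw [Subgroup.index_comap]
      exact Subgroup.FiniteIndex.index_ne_zero (H := K.subgroupOf f.range)⟩

theorem Subgroup.finiteIndex_map_mulEquiv {G H : Type*} [Group G] [Group H] (e : G ≃* H)
    (K : Subgroup G) [hK : K.FiniteIndex] : (K.map (e : G →* H)).FiniteIndex :=
  ⟨by rw [Subgroup.index_map_equiv]; exact hK.index_ne_zero⟩

section FiberSquare

variable {F P : Type u} [Group F] [Group P] {ψ : F →* P}

theorem MonoidHom.diag_mem_fiberSquare (a : F) : (a, a) ∈ ψ.fiberSquare :=
  MonoidHom.mem_fiberSquare.2 rfl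

theorem MonoidHom.isSubdirectProduct_fiberSquare : IsSubdirectProduct ψ.fiberSquare :=
  ⟨eq_top_iff.2 fun a _ => ⟨(a, a), ψ.diag_mem_fiberSquare a, rfl⟩,
    eq_top_iff.2 fun a _ => ⟨(a, a), ψ.diag_mem_fiberSquare a, rfl⟩⟩

theorem MonoidHom.leftKernel_fiberSquare : ψ.fiberSquare.leftKernel = ψ.ker := by
  ext a
  rw [Subgroup.mem_leftKernel, MonoidHom.mem_fiberSquare, MonoidHom.mem_ker, map_one]

theorem MonoidHom.rightKernel_fiberSquare : ψ.fiberSquare.rightKernel = ψ.ker := by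
  ext a
  rw [Subgroup.mem_rightKernel, MonoidHom.mem_fiberSquare, MonoidHom.mem_ker, map_one, eq_comm]

/-- The fibre square of a homomorphism is finitely generated if its kernel is finitely generated as
a normal subgroup. -/
theorem MonoidHom.fg_fiberSquare [Group.FG F] (hψ : ψ.ker.IsFinitelyNormallyGenerated) :
    Group.FG ψ.fiberSquare := by
  obtain ⟨S, hS, hker⟩ := hψ
  let δ : F →* F × F := (MonoidHom.id F).prod (MonoidHom.id F)
  let L : Subgroup (F × F) := δ.range ⊔ Subgroup.closure (MonoidHom.inl F F '' S)
  have hL : L.FG := ((Group.fg_iff_subgroup_fg _).1 (Group.fg_range δ)).sup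
    ((Subgroup.fg_iff _).2 ⟨_, rfl, hS.image _⟩)
  have hδ (a : F) : (a, a) ∈ L := (le_sup_left : _ ≤ L) ⟨a, rfl⟩
  -- The diagonal realises conjugation by all of `F` on the first coordinate, so normal generators
  -- of the kernel suffice.
  have : (L.comap (MonoidHom.inl F F)).Normal := ⟨fun r hr a => by
    have := L.mul_mem (L.mul_mem (hδ a) hr) (L.inv_mem (hδ a))
    simpa [Subgroup.mem_comap] using this⟩
  have hle : ψ.ker ≤ L.comap (MonoidHom.inl F F) := by
    rw [← hker]
    refine Subgroup.normalClosure_le_normal fun s hs => ?_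
    exact (le_sup_right : _ ≤ L) (Subgroup.subset_closure ⟨s, hs, rfl⟩)
  suffices ψ.fiberSquare = L from this ▸ (Group.fg_iff_subgroup_fg L).2 hL
  refine le_antisymm ?_ (sup_le ?_ ?_)
  · rintro ⟨a, b⟩ hab
    have h1 : a * b⁻¹ ∈ ψ.ker := by
      rw [MonoidHom.mem_ker, map_mul, map_inv, mul_inv_eq_one]
      exact hab
    have := L.mul_mem (hle h1) (hδ b)
    simpa using this
  · rintro _ ⟨a, rfl⟩
    exact ψ.diag_mem_fiberSquare a
  · rw [Subgroup.closure_le]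
    rintro _ ⟨a, ha, rfl⟩
    have : a ∈ ψ.ker := hker ▸ Subgroup.subset_normalClosure ha
    rw [← MonoidHom.leftKernel_fiberSquare] at this
    exact this

end FiberSquare

/-- The fibre square of a presentation of an infinite torsion group is a full subdirect product of
infinite index. -/
theorem MonoidHom.isFullSubdirectProduct_fiberSquare {F P : Type u} [Group F] [IsMulTorsionFree F]
    [Group P] [Infinite P] (htors : IsMulTorsion P) {ψ : F →* P}
    (hψ : Function.Surjective ψ) :
    IsFullSubdirectProduct ψ.fiberSquare ∧ ¬ ψ.fiberSquare.FiniteIndex := by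
  have hker : ψ.ker ≠ ⊥ := fun hbot => by
    have hinj := (MonoidHom.ker_eq_bot_iff ψ).1 hbot
    have : Subsingleton P := ⟨fun x y => by
      obtain ⟨a, rfl⟩ := hψ x
      obtain ⟨b, rfl⟩ := hψ y
      have h1 (c : F) : c = 1 := (hinj.isOfFinOrder_iff.1 (htors (ψ c))).eq_one'
      rw [h1 a, h1 b]⟩
    exact not_finite P
  refine ⟨⟨MonoidHom.isSubdirectProduct_fiberSquare, ?_, ?_⟩, fun hfin => ?_⟩
  · rw [Subgroup.inf_prod_top_bot_ne_bot, MonoidHom.leftKernel_fiberSquare]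
    exact hker
  · rw [Subgroup.inf_prod_bot_top_ne_bot, MonoidHom.rightKernel_fiberSquare]
    exact hker
  · have : ψ.ker.FiniteIndex := by
      rw [← MonoidHom.leftKernel_fiberSquare]
      exact Subgroup.finiteIndex_comap _ _
    have : Finite (F ⧸ ψ.ker) := Subgroup.finite_quotient_of_finiteIndex
    have := Finite.of_equiv _ (QuotientGroup.quotientKerEquivOfSurjective ψ hψ).toEquiv
    exact not_finite P

/-! ### Virtual products of free groups. -/

section Virtually

theorem IsDirectProductOfTwoFreeGroups.of_mulEquiv {G A B : Type u} [Group G] [Group A] [Group B]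
    [IsFreeGroup A] [IsFreeGroup B] (e : G ≃* A × B) : IsDirectProductOfTwoFreeGroups G :=
  ⟨IsFreeGroup.Generators A, IsFreeGroup.Generators B,
    ⟨e.trans ((IsFreeGroup.toFreeGroup A).prodCongr (IsFreeGroup.toFreeGroup B))⟩⟩

theorem IsFreeGroup.isDirectProductOfTwoFreeGroups {F : Type u} [Group F] [IsFreeGroup F] :
    IsDirectProductOfTwoFreeGroups F :=
  .of_mulEquiv (MulEquiv.prodUnique (M := F) (N := FreeGroup PEmpty.{u + 1})).symm

theorem IsVirtuallyDirectProductOfTwoFreeGroups.of_mulEquiv {G H : Type u} [Group G] [Group H]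
    (e : G ≃* H) (h : IsVirtuallyDirectProductOfTwoFreeGroups G) :
    IsVirtuallyDirectProductOfTwoFreeGroups H := by
  obtain ⟨K, hK, A, B, ⟨f⟩⟩ := h
  exact ⟨K.map (e : G →* H), Subgroup.finiteIndex_map_mulEquiv e K, A, B,
    ⟨(e.subgroupMap K).symm.trans f⟩⟩

theorem IsDirectProductOfTwoFreeGroups.virtually {G : Type u} [Group G]
    (h : IsDirectProductOfTwoFreeGroups G) : IsVirtuallyDirectProductOfTwoFreeGroups G := by
  obtain ⟨A, B, ⟨f⟩⟩ := h
  exact ⟨⊤, inferInstance, A, B, ⟨Subgroup.topEquiv.trans f⟩⟩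

variable {F₁ F₂ : Type u} [Group F₁] [Group F₂] [IsFreeGroup F₁] [IsFreeGroup F₂]
  {G : Subgroup (F₁ × F₂)}

/-- A subdirect product of two free groups that is not virtually a product of two free groups is
full and has infinite index. -/
theorem IsSubdirectProduct.isFullSubdirectProduct (h : IsSubdirectProduct G)
    (hG : ¬ IsVirtuallyDirectProductOfTwoFreeGroups G) :
    IsFullSubdirectProduct G ∧ ¬ G.FiniteIndex := by
  refine ⟨⟨h, ?_, ?_⟩, fun hfin => hG ?_⟩
  · rw [Subgroup.inf_prod_top_bot_ne_bot]
    intro hbot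
    have hinj : Function.Injective ((MonoidHom.snd F₁ F₂).comp G.subtype) := by
      refine (injective_iff_map_eq_one _).2 ?_
      rintro ⟨⟨a, b⟩, hab⟩ hb
      obtain rfl : b = 1 := hb
      obtain rfl : a = 1 := (Subgroup.eq_bot_iff_forall _).1 hbot a hab
      rfl
    exact hG (IsVirtuallyDirectProductOfTwoFreeGroups.of_mulEquiv
      (MulEquiv.ofBijective _ ⟨hinj, h.snd_surjective⟩).symm
      IsFreeGroup.isDirectProductOfTwoFreeGroups.virtually)
  · rw [Subgroup.inf_prod_bot_top_ne_bot]
    intro hbot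
    have hinj : Function.Injective ((MonoidHom.fst F₁ F₂).comp G.subtype) := by
      refine (injective_iff_map_eq_one _).2 ?_
      rintro ⟨⟨a, b⟩, hab⟩ ha
      obtain rfl : a = 1 := ha
      obtain rfl : b = 1 := (Subgroup.eq_bot_iff_forall _).1 hbot b hab
      rfl
    exact hG (IsVirtuallyDirectProductOfTwoFreeGroups.of_mulEquiv
      (MulEquiv.ofBijective _ ⟨hinj, h.fst_surjective⟩).symm
      IsFreeGroup.isDirectProductOfTwoFreeGroups.virtually)
  · have hle : G.leftKernel.prod G.rightKernel ≤ G := by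
      rintro ⟨a, b⟩ ⟨ha, hb⟩
      have := G.mul_mem (Subgroup.mem_leftKernel.1 ha) (Subgroup.mem_rightKernel.1 hb)
      simpa using this
    have hl : G.leftKernel.FiniteIndex := Subgroup.finiteIndex_comap _ _
    have hr : G.rightKernel.FiniteIndex := Subgroup.finiteIndex_comap _ _
    have hfin' : (G.leftKernel.prod G.rightKernel).FiniteIndex :=
      ⟨by rw [Subgroup.index_prod]; exact mul_ne_zero hl.index_ne_zero hr.index_ne_zero⟩
    exact ⟨(G.leftKernel.prod G.rightKernel).subgroupOf G, inferInstance, .of_mulEquiv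
      ((Subgroup.subgroupOfEquivOfLe hle).trans (Subgroup.prodEquiv _ _))⟩

end Virtually

/-- A subgroup of a product is a subdirect product of its projections. -/
theorem Subgroup.exists_isSubdirectProduct {H₁ H₂ : Type u} [Group H₁] [Group H₂]
    (G : Subgroup (H₁ × H₂)) :
    ∃ G' : Subgroup (G.map (MonoidHom.fst H₁ H₂) × G.map (MonoidHom.snd H₁ H₂)),
      IsSubdirectProduct G' ∧ Nonempty (G ≃* G') := by
  let j : G →* G.map (MonoidHom.fst H₁ H₂) × G.map (MonoidHom.snd H₁ H₂) :=
    ((MonoidHom.fst H₁ H₂).subgroupMap G).prod ((MonoidHom.snd H₁ H₂).subgroupMap G)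
  have hj : Function.Injective j := fun g h hgh => Subtype.ext <| Prod.ext
    (congrArg Subtype.val (congrArg Prod.fst hgh)) (congrArg Subtype.val (congrArg Prod.snd hgh))
  refine ⟨j.range, ⟨eq_top_iff.2 ?_, eq_top_iff.2 ?_⟩, ⟨MonoidHom.ofInjective hj⟩⟩
  · rintro ⟨_, g, hg, rfl⟩ -
    exact ⟨j ⟨g, hg⟩, ⟨_, rfl⟩, rfl⟩
  · rintro ⟨_, g, hg, rfl⟩ -
    exact ⟨j ⟨g, hg⟩, ⟨_, rfl⟩, rfl⟩

/-! ### Change of universe and the implications. -/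

/-- A full subdirect product of infinite index can be moved to any larger universe. -/
theorem IsFullSubdirectProduct.exists_ulift {F₁ F₂ : Type} [Group F₁] [Group F₂]
    {G : Subgroup (F₁ × F₂)} (h : IsFullSubdirectProduct G) (hidx : ¬ G.FiniteIndex) :
    ∃ G' : Subgroup (ULift.{u} F₁ × ULift.{u} F₂),
      IsFullSubdirectProduct G' ∧ ¬ G'.FiniteIndex ∧ Nonempty (G ≃* G') := by
  let e : F₁ × F₂ ≃* ULift.{u} F₁ × ULift.{u} F₂ :=
    MulEquiv.ulift.symm.prodCongr MulEquiv.ulift.symm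
  obtain ⟨h, hl, hr⟩ := h
  have hmem {a : F₁} {b : F₂} : (ULift.up a, ULift.up b) ∈ G.map (e : _ →* _) ↔ (a, b) ∈ G :=
    Subgroup.mem_map_iff_mem e.injective (x := (a, b))
  refine ⟨G.map (e : _ →* _), ⟨⟨eq_top_iff.2 ?_, eq_top_iff.2 ?_⟩, ?_, ?_⟩, fun hfin => hidx ?_,
    ⟨e.subgroupMap G⟩⟩
  · rintro ⟨a⟩ -
    obtain ⟨b, hb⟩ := h.exists_snd a
    exact ⟨_, hmem.2 hb, rfl⟩
  · rintro ⟨b⟩ -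
    obtain ⟨a, ha⟩ := h.exists_fst b
    exact ⟨_, hmem.2 ha, rfl⟩
  · rw [Subgroup.inf_prod_top_bot_ne_bot] at hl ⊢
    refine fun hbot => hl ((Subgroup.eq_bot_iff_forall _).2 fun a ha => ?_)
    exact congrArg ULift.down ((Subgroup.eq_bot_iff_forall _).1 hbot ⟨a⟩ (hmem.2 ha))
  · rw [Subgroup.inf_prod_bot_top_ne_bot] at hr ⊢
    refine fun hbot => hr ((Subgroup.eq_bot_iff_forall _).2 fun b hb => ?_)
    exact congrArg ULift.down ((Subgroup.eq_bot_iff_forall _).1 hbot ⟨b⟩ (hmem.2 hb))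
  · rw [Subgroup.finiteIndex_iff, Subgroup.index_map_equiv] at hfin
    exact ⟨hfin⟩

theorem exists_isFullSubdirectProduct_of_isPGroup {p : ℕ} [Fact p.Prime] {P : Type u} [Group P]
    [Infinite P] (hfp : Group.IsFinitelyPresented P) (hres : Group.ResiduallyFinite P)
    (hP : IsPGroup p P) :
    ∃ (F₁ F₂ : Type u) (_ : Group F₁) (_ : Group F₂) (G : Subgroup (F₁ × F₂)),
      IsFreeGroup F₁ ∧ IsFreeGroup F₂ ∧ Group.FG G ∧ IsPConjugacySeparable p G ∧
        IsFullSubdirectProduct G ∧ ¬ G.FiniteIndex := by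
  obtain ⟨n, φ, hφ, hker⟩ := hfp.out
  let e : FreeGroup (ULift.{u} (Fin n)) ≃* FreeGroup (Fin n) :=
    FreeGroup.freeGroupCongr Equiv.ulift
  let ψ := φ.comp (e : FreeGroup (ULift.{u} (Fin n)) →* FreeGroup (Fin n))
  have hψ : Function.Surjective ψ := hφ.comp e.surjective
  have hkerψ : ψ.ker.IsFinitelyNormallyGenerated := by
    have : ψ.ker = φ.ker.map (e.symm : FreeGroup (Fin n) →* FreeGroup (ULift.{u} (Fin n))) := by
      rw [Subgroup.map_equiv_eq_comap_symm]
      rfl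
    rw [this]
    exact hker.map e.symm.surjective
  have htors : IsMulTorsion P := fun x => isOfFinOrder_iff_pow_eq_one.2 <| by
    obtain ⟨k, hk⟩ := hP x
    exact ⟨p ^ k, pow_pos (Fact.out : p.Prime).pos k, hk⟩
  have hfull := MonoidHom.isFullSubdirectProduct_fiberSquare htors hψ
  exact ⟨_, _, _, _, ψ.fiberSquare, inferInstance, inferInstance, MonoidHom.fg_fiberSquare hkerψ,
    IsFreeGroup.isPConjugacySeparable_fiberSquare hres hP ψ, hfull.1, hfull.2⟩

theorem IsFullSubdirectProduct.exists_infinite_isPGroup {p : ℕ} (hp : p.Prime) {F₁ F₂ : Type u}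
    [Group F₁] [Group F₂] [IsFreeGroup F₁] [IsFreeGroup F₂] {G : Subgroup (F₁ × F₂)}
    (h : IsFullSubdirectProduct G) (hfg : Group.FG G) (hG : IsPConjugacySeparable p G)
    (hidx : ¬ G.FiniteIndex) :
    ∃ (P : Type u) (_ : Group P),
      Infinite P ∧ Group.IsFinitelyPresented P ∧ Group.ResiduallyFinite P ∧ IsPGroup p P := by
  obtain ⟨h, hl, hr⟩ := h
  rw [Subgroup.inf_prod_top_bot_ne_bot] at hl
  rw [Subgroup.inf_prod_bot_top_ne_bot] at hr
  have := h.normal_leftKernel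
  refine ⟨F₁ ⧸ G.leftKernel, inferInstance, ?_, h.isFinitelyPresented_quotient hfg,
    h.residuallyFinite_quotient hG hl hr hidx, h.isPGroup_quotient hp hG hl hr hidx⟩
  rw [← not_finite_iff_infinite, ← Subgroup.finiteIndex_iff_finite_quotient]
  exact fun hfin => hidx (h.finiteIndex_of_leftKernel hfin)

theorem IsFullSubdirectProduct.exists_subgroup_freeGroup_fin_two {p : ℕ} {F₁ F₂ : Type u}
    [Group F₁] [Group F₂] [IsFreeGroup F₁] [IsFreeGroup F₂] {G : Subgroup (F₁ × F₂)}
    (h : IsFullSubdirectProduct G) (hfg : Group.FG G) (hG : IsPConjugacySeparable p G)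
    (hidx : ¬ G.FiniteIndex) :
    ∃ G : Subgroup (FreeGroup (Fin 2) × FreeGroup (Fin 2)),
      Group.FG G ∧ IsPConjugacySeparable p G ∧ ¬ IsVirtuallyDirectProductOfTwoFreeGroups G := by
  obtain ⟨h, hl, hr⟩ := h
  rw [Subgroup.inf_prod_top_bot_ne_bot] at hl
  rw [Subgroup.inf_prod_bot_top_ne_bot] at hr
  have : Group.FG F₁ := Group.fg_of_surjective h.fst_surjective
  have : Group.FG F₂ := Group.fg_of_surjective h.snd_surjective
  obtain ⟨f₁, hf₁⟩ := IsFreeGroup.exists_injective_freeGroup_fin_two F₁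
  obtain ⟨f₂, hf₂⟩ := IsFreeGroup.exists_injective_freeGroup_fin_two F₂
  let e := G.equivMapOfInjective (f₁.prodMap f₂) (hf₁.prodMap hf₂)
  refine ⟨G.map (f₁.prodMap f₂), Group.fg_of_surjective (f := e.toMonoidHom) e.surjective,
    hG.of_mulEquiv e, ?_⟩
  rintro ⟨K, hK, A, B, ⟨i⟩⟩
  have := Subgroup.finiteIndex_map_mulEquiv e.symm K
  exact (h.isEmpty_mulEquiv_prod hl hr hidx (K.map (e.symm : _ →* G))).false
    ((e.symm.subgroupMap K).symm.trans i)

theorem exists_isFullSubdirectProduct_of_not_isVirtually {p : ℕ} {H : Type} [Group H]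
    [IsFreeGroup H] {G : Subgroup (H × H)} (hfg : Group.FG G) (hG : IsPConjugacySeparable p G)
    (hv : ¬ IsVirtuallyDirectProductOfTwoFreeGroups G) :
    ∃ (F₁ F₂ : Type u) (_ : Group F₁) (_ : Group F₂) (G : Subgroup (F₁ × F₂)),
      IsFreeGroup F₁ ∧ IsFreeGroup F₂ ∧ Group.FG G ∧ IsPConjugacySeparable p G ∧
        IsFullSubdirectProduct G ∧ ¬ G.FiniteIndex := by
  obtain ⟨G₁, h₁, ⟨e₁⟩⟩ := G.exists_isSubdirectProduct
  obtain ⟨hfull, hidx⟩ := h₁.isFullSubdirectProduct fun h => hv (h.of_mulEquiv e₁.symm)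
  obtain ⟨G₂, h₂, hidx₂, ⟨e₂⟩⟩ := hfull.exists_ulift.{u} hidx
  let e := e₁.trans e₂
  exact ⟨_, _, _, _, G₂, IsFreeGroup.ofMulEquiv MulEquiv.ulift.symm,
    IsFreeGroup.ofMulEquiv MulEquiv.ulift.symm,
    Group.fg_of_surjective (f := e.toMonoidHom) e.surjective, hG.of_mulEquiv e, h₂, hidx₂⟩

theorem corollary1p6 (p : ℕ) (hp : p.Prime) :
    List.TFAE [
      ∃ (P : Type u) (_ : Group P),
        Infinite P ∧ Group.IsFinitelyPresented P ∧ Group.ResiduallyFinite P ∧ IsPGroup p P,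
      ∃ G : Subgroup (FreeGroup (Fin 2) × FreeGroup (Fin 2)),
        Group.FG G ∧ IsPConjugacySeparable p G ∧ ¬ IsVirtuallyDirectProductOfTwoFreeGroups G,
      ∃ (F₁ F₂ : Type u) (_ : Group F₁) (_ : Group F₂) (G : Subgroup (F₁ × F₂)),
        IsFreeGroup F₁ ∧ IsFreeGroup F₂ ∧ Group.FG G ∧ IsPConjugacySeparable p G ∧
          IsFullSubdirectProduct G ∧ ¬ G.FiniteIndex] := by
  have : Fact p.Prime := ⟨hp⟩
  tfae_have 1 → 3 := fun ⟨_, _, _, hfp, hres, hP⟩ =>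
    exists_isFullSubdirectProduct_of_isPGroup hfp hres hP
  tfae_have 3 → 1 := fun ⟨_, _, _, _, _, _, _, hfg, hG, h, hidx⟩ =>
    h.exists_infinite_isPGroup hp hfg hG hidx
  tfae_have 3 → 2 := fun ⟨_, _, _, _, _, _, _, hfg, hG, h, hidx⟩ =>
    h.exists_subgroup_freeGroup_fin_two hfg hG hidx
  tfae_have 2 → 3 := fun ⟨_, hfg, hG, hv⟩ =>
    exists_isFullSubdirectProduct_of_not_isVirtually hfg hG hv
  tfae_finish
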